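/- Consider the Poisson bipolar network in $\mathbb{R}^d$, $d\ge 1$, with slotted ALOHA. A receiver is at the origin, its desired transmitter is at a point $x_0$ with $|x_0|=r_0>0$, and the interferers form a homogeneous Poisson point process $\{x_i\}$ of intensity $\lambda>0$ (equivalently, one works under the Palm distribution of the process of all transmitters given a point at $x_0$). The path loss is $|x|^{-\alpha}$ with $\alpha>d$. In each time slot $k=1,2,\dots$, each transmitter $x$ (including $x_0$) transmits with probability $p\in(0,1)$, and its power fading coefficient to the receiver is $h_{k,x}$, exponentially distributed with unit mean; all transmission decisions (over transmitters and slots), all fading coefficients and the point process are mutually independent. With bandwidth $W>0$, normalized noise power spectral density $N_0\ge 0$ and $\Phi_k$ the set of transmitters that transmit in slot $k$, put $$\mathrm{SINR}_k=\frac{h_{k,x_0}r_0^{-\alpha}}{WN_0+\sum_i h_{k,x_i}|x_i|^{-\alpha}\mathbf 1(x_i\in\Phi_k)}.$$ Slot $k$ is successful if $x_0$ transmits in it and $\mathrm{SINR}_k>\theta$, where $\theta>0$ is a fixed threshold. The local delay $\Delta$ is the number of slots up to and including the first successful one. Let $\delta=d/\alpha$, $A=\lambda c_d r_0^d\theta^\delta\,\frac{\pi\delta}{\sin(\pi\delta)}$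 and $B=\theta r_0^\alpha WN_0$, where $c_d$ is the volume of the $d$-dimensional unit ball. Then $\Delta$ is almost surely finite and has a finite second moment, its mean is $$\widetilde D(p)=\frac1p\exp\Big(\frac{pA}{(1-p)^{1-\delta}}+B\Big),$$ and its variance is $$\widetilde V(p)=\frac{2}{p^2}\exp\Big(\frac{(2-p-\delta p)\,pA}{(1-p)^{2-\delta}}+2B\Big)-\widetilde D(p)-\widetilde D(p)^2 .$$ -/

import Mathlib

open MeasureTheory ProbabilityTheory
open scoped ENNReal

noncomputable section

/-- The number of points (counted with multiplicity) of the random sequence `X` in `B`. -/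
def pointCount {Ω E : Type*} (X : ℕ → Ω → E) (B : Set E) (ω : Ω) : ℕ∞ :=
  {i : ℕ | X i ω ∈ B}.encard

/-- The random points `X 0, X 1, X 2, …` form a Poisson point process with intensity measure `ν`:
the number of points in a measurable set `B` of finite intensity is Poisson distributed with mean
`ν B`, and the numbers of points in disjoint such sets are independent. -/
structure IsPoissonPointProcess {Ω E : Type*} [MeasurableSpace Ω] [MeasurableSpace E]
    (X : ℕ → Ω → E) (ν : Measure E) (P : Measure Ω) : Prop where
  measurable_point : ∀ i, Measurable (X i)
  count_law : ∀ B : Set E, MeasurableSet B → ν B ≠ ∞ → ∀ n : ℕ,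
    P {ω | pointCount X B ω = (n : ℕ∞)} = poissonMeasure (ν B).toNNReal {n}
  count_indep : ∀ (n : ℕ) (B : Fin n → Set E), (∀ j, MeasurableSet (B j)) →
    (∀ j, ν (B j) ≠ ∞) → Pairwise (fun i j => Disjoint (B i) (B j)) →
    iIndepFun (fun j ω => pointCount X (B j) ω) P

/-- The Poisson bipolar network with slotted ALOHA, seen from the receiver at the origin and
conditioned on the desired transmitter being present.

Transmitters are indexed by `Option ℕ`: `none` is the desired transmitter, and `some i` is the
interferer located at the random point `X i`; the interferers form a homogeneous Poisson point
process of intensity `lam`. Time slots are indexed by `k : ℕ`, slot `0` being the first one.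
`h k j` is the power fading coefficient between transmitter `j` and the receiver in slot `k`
(exponential of unit mean), and `t k j` says whether `j` transmits in slot `k` (with probability
`p`). All the `h k j`, all the `t k j` and the point process are mutually independent. -/
structure IsAlohaNetwork {Ω : Type*} [MeasurableSpace Ω] {d : ℕ} (lam p : ℝ)
    (X : ℕ → Ω → EuclideanSpace ℝ (Fin d)) (h : ℕ → Option ℕ → Ω → ℝ)
    (t : ℕ → Option ℕ → Ω → Bool) (P : Measure Ω) : Prop where
  poisson : IsPoissonPointProcess X (ENNReal.ofReal lam • volume) P
  measurable_fading : ∀ k j, Measurable (h k j)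
  fading_law : ∀ k j, P.map (h k j) = expMeasure 1
  measurable_transmit : ∀ k j, Measurable (t k j)
  transmit_prob : ∀ k j, P {ω | t k j ω = true} = ENNReal.ofReal p
  indep_fading_transmit : ∀ k j, IndepFun (h k j) (t k j) P
  indep_marks : iIndepFun (fun (kj : ℕ × Option ℕ) ω => (h kj.1 kj.2 ω, t kj.1 kj.2 ω)) P
  indep_points_marks : IndepFun (fun ω (i : ℕ) => X i ω)
    (fun ω (kj : ℕ × Option ℕ) => (h kj.1 kj.2 ω, t kj.1 kj.2 ω)) P

/-- The power received at the origin, through fading `g`, from an active transmitter at `x`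
(normalized path loss `|x| ^ (-α)`, equal to `∞` at `x = 0`). -/
def receivedPower {d : ℕ} (α g : ℝ) (x : EuclideanSpace ℝ (Fin d)) : ℝ≥0∞ :=
  ENNReal.ofReal g * ‖x‖ₑ ^ (-α)

/-- The interference at the origin in slot `k`: the total power received from the interferers that
transmit in this slot. -/
def interference {Ω : Type*} {d : ℕ} (α : ℝ) (X : ℕ → Ω → EuclideanSpace ℝ (Fin d))
    (h : ℕ → Option ℕ → Ω → ℝ) (t : ℕ → Option ℕ → Ω → Bool) (k : ℕ) (ω : Ω) : ℝ≥0∞ :=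
  ∑' i : ℕ, if t k (some i) ω = true then receivedPower α (h k (some i) ω) (X i ω) else 0

/-- The SINR in slot `k` of the desired link from `x₀` to the origin, with bandwidth `W` and
normalized noise power spectral density `N₀`. -/
def sinr {Ω : Type*} {d : ℕ} (α W N₀ : ℝ) (x₀ : EuclideanSpace ℝ (Fin d))
    (X : ℕ → Ω → EuclideanSpace ℝ (Fin d))
    (h : ℕ → Option ℕ → Ω → ℝ) (t : ℕ → Option ℕ → Ω → Bool) (k : ℕ) (ω : Ω) : ℝ≥0∞ :=
  receivedPower α (h k none ω) x₀ / (ENNReal.ofReal (W * N₀) + interference α X h t k ω)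

/-- The packet is successfully received in slot `k`: the desired transmitter transmits and the SINR
exceeds the threshold `θ`. -/
def Success {Ω : Type*} {d : ℕ} (α W N₀ θ : ℝ) (x₀ : EuclideanSpace ℝ (Fin d))
    (X : ℕ → Ω → EuclideanSpace ℝ (Fin d))
    (h : ℕ → Option ℕ → Ω → ℝ) (t : ℕ → Option ℕ → Ω → Bool) (k : ℕ) (ω : Ω) : Prop :=
  t k none ω = true ∧ ENNReal.ofReal θ < sinr α W N₀ x₀ X h t k ω

/-- The local delay: the number of slots until the packet is successfully received (`⊤` if this
never happens). -/
def localDelay {Ω : Type*} {d : ℕ} (α W N₀ θ : ℝ) (x₀ : EuclideanSpace ℝ (Fin d))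
    (X : ℕ → Ω → EuclideanSpace ℝ (Fin d))
    (h : ℕ → Option ℕ → Ω → ℝ) (t : ℕ → Option ℕ → Ω → Bool) (ω : Ω) : ℕ∞ :=
  ⨅ (k : ℕ) (_ : Success α W N₀ θ x₀ X h t k ω), ((k + 1 : ℕ) : ℕ∞)

end

/-! Condition on the interferer positions. The marks of different slots are i.i.d., so the delay is
then geometric with some success probability Q, and the first two moments reduce to E[1/Q] and
E[1/Q²]: E[Δ] = E[1/Q] and E[Δ² + Δ] = 2 E[1/Q²].

Success means that the exponential fading of the desired link exceeds the scaled noise plus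
interference. The exponential tail turns this probability into a Laplace transform, which factors
over the interferers: Q = p e^(-B) ∏ L(sᵢ) with L(s) = 1 - p + p / (1 + s) (`measure_slot_success`).

Hence 1/Q and 1/Q² are constants times products over the points of a Poisson process, and the
exponential formula (`lintegral_eexp_tsum`) evaluates their means as exponentials of the integrals
of 1/L - 1 and 1/L² - 1. Since 1/L = 1 + pc / (‖x‖^α + (1-p)c) with c = θ r₀^α, these are Gamma
integrals in polar coordinates, and the reflection formula yields πδ / sin(πδ).

Expectations are computed in `ℝ≥0∞`, where no integrability has to be checked beforehand; almost
sure finiteness and the second moment follow because the resulting values are finite. -/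

/-! ### Exponential and logarithm on the extended nonnegative reals. -/

/-- The exponential `ℝ≥0∞ → ℝ≥0∞`, with `eexp ∞ = ∞`. -/
noncomputable def eexp (u : ℝ≥0∞) : ℝ≥0∞ := EReal.exp (u : EReal)

lemma eexp_zero : eexp 0 = 1 := by simp [eexp]

lemma eexp_top : eexp ∞ = ∞ := by simp [eexp]

lemma eexp_ofReal {x : ℝ} (hx : 0 ≤ x) : eexp (ENNReal.ofReal x) = ENNReal.ofReal (Real.exp x) := by
  simp [eexp, EReal.coe_ennreal_ofReal, hx]

lemma eexp_add (u v : ℝ≥0∞) : eexp (u + v) = eexp u * eexp v := by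
  simp [eexp, EReal.coe_ennreal_add, EReal.exp_add]

lemma eexp_sum {ι : Type*} (s : Finset ι) (u : ι → ℝ≥0∞) :
    eexp (∑ i ∈ s, u i) = ∏ i ∈ s, eexp (u i) := by
  classical
  induction s using Finset.induction_on with
  | empty => simp [eexp_zero]
  | insert a s ha ih => rw [Finset.sum_insert ha, Finset.prod_insert ha, eexp_add, ih]

lemma continuous_eexp : Continuous eexp :=
  ENNReal.continuous_exp.comp continuous_coe_ennreal_ereal

@[fun_prop]
lemma measurable_eexp : Measurable eexp := continuous_eexp.measurable

lemma eexp_mono : Monotone eexp := fun u v huv => by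
  simpa [eexp] using huv

lemma one_le_eexp (u : ℝ≥0∞) : 1 ≤ eexp u := by
  rw [← eexp_zero]; exact eexp_mono zero_le

lemma eexp_ne_zero (u : ℝ≥0∞) : eexp u ≠ 0 :=
  (zero_lt_one.trans_le (one_le_eexp u)).ne'

/-- The inverse of `eexp` on `[1, ∞]`. -/
noncomputable def elog (y : ℝ≥0∞) : ℝ≥0∞ := (ENNReal.log y).toENNReal

lemma eexp_elog {y : ℝ≥0∞} (hy : 1 ≤ y) : eexp (elog y) = y := by
  rw [eexp, elog, EReal.coe_toENNReal (by simpa using hy), ENNReal.exp_log]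

@[fun_prop]
lemma measurable_elog : Measurable elog := ENNReal.measurable_log.ereal_toENNReal

/-! ### Exponential formula for Poisson point processes. -/

section Poisson

variable {Ω E : Type*} [MeasurableSpace Ω] [MeasurableSpace E] {X : ℕ → Ω → E} {ν : Measure E}
  {P : Measure Ω}

lemma measurable_pointCount (hX : ∀ i, Measurable (X i)) {B : Set E} (hB : MeasurableSet B) :
    Measurable (pointCount X B) := by
  refine measurable_encard.comp (measurable_set_iff.2 fun i => ?_)
  exact measurable_mem.2 (hX i hB)

lemma tsum_indicator_pointCount {Ω E : Type*} (X : ℕ → Ω → E) (B : Set E) (c : ℝ≥0∞) (ω : Ω) :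
    ∑' i, B.indicator (fun _ => c) (X i ω) = c * (pointCount X B ω : ℝ≥0∞) := by
  have h : ∀ i, B.indicator (fun _ => c) (X i ω) =
      {i : ℕ | X i ω ∈ B}.indicator (fun _ => c) i := fun i => by
    simp [Set.indicator]
  simp_rw [h]
  rw [← tsum_subtype, ENNReal.tsum_set_const, mul_comm]
  rfl

lemma lintegral_eexp_poissonMeasure (r : NNReal) (c : NNReal) :
    ∫⁻ n, eexp (c * (n : ℝ≥0∞)) ∂(poissonMeasure r) = eexp (r * (eexp c - 1)) := by
  have hc : eexp c = ENNReal.ofReal (Real.exp c) := by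
    rw [← eexp_ofReal c.coe_nonneg, ENNReal.ofReal_coe_nnreal]
  have hr : (r : ℝ≥0∞) * (eexp c - 1) = ENNReal.ofReal (r * (Real.exp c - 1)) := by
    rw [hc, ENNReal.ofReal_mul r.coe_nonneg, ENNReal.ofReal_sub _ zero_le_one, ENNReal.ofReal_one,
      ENNReal.ofReal_coe_nnreal]
  have h1 : (1 : ℝ) ≤ Real.exp c := Real.one_le_exp c.coe_nonneg
  rw [hr, eexp_ofReal (mul_nonneg r.coe_nonneg (by linarith)), lintegral_countable']
  have h : ∀ n : ℕ, eexp (c * (n : ℝ≥0∞)) * poissonMeasure r {n} =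
      ENNReal.ofReal (Real.exp (-r) * ((r * Real.exp c) ^ n / n.factorial)) := fun n => by
    rw [poissonMeasure_singleton,
      show (c : ℝ≥0∞) * n = ENNReal.ofReal (c * n) by
        rw [ENNReal.ofReal_mul c.coe_nonneg, ENNReal.ofReal_coe_nnreal, ENNReal.ofReal_natCast],
      eexp_ofReal (by positivity), ← ENNReal.ofReal_mul (by positivity), mul_pow,
      ← Real.exp_nat_mul, mul_comm (n : ℝ)]
    congr 1
    ring
  simp_rw [h]
  have hs : HasSum (fun n : ℕ => (r * Real.exp c) ^ n / n.factorial)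
      (Real.exp (r * Real.exp c)) := by
    rw [Real.exp_eq_exp_ℝ]
    exact NormedSpace.expSeries_div_hasSum_exp _
  have hs' := hs.mul_left (Real.exp (-r))
  rw [← ENNReal.ofReal_tsum_of_nonneg (fun n => by positivity) hs'.summable, hs'.tsum_eq,
    ← Real.exp_add]
  congr 2
  ring

/-- The definition of the process prescribes only the masses of finite counts. Both laws are
probability measures, so the mass at `⊤` is forced to agree as well. -/
lemma map_pointCount [IsProbabilityMeasure P] (hX : IsPoissonPointProcess X ν P) {B : Set E}
    (hB : MeasurableSet B) (hν : ν B ≠ ∞) :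
    P.map (pointCount X B) = (poissonMeasure (ν B).toNNReal).map (Nat.cast : ℕ → ℕ∞) := by
  have hm := measurable_pointCount hX.measurable_point hB
  have hc : Measurable (Nat.cast : ℕ → ℕ∞) := measurable_from_top
  have := Measure.isProbabilityMeasure_map (μ := P) hm.aemeasurable
  have := Measure.isProbabilityMeasure_map (μ := poissonMeasure (ν B).toNNReal) hc.aemeasurable
  have hn : ∀ n : ℕ, P.map (pointCount X B) {(n : ℕ∞)} =
      (poissonMeasure (ν B).toNNReal).map (Nat.cast : ℕ → ℕ∞) {(n : ℕ∞)} := fun n => by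
    rw [Measure.map_apply hm (measurableSet_singleton _),
      Measure.map_apply hc (measurableSet_singleton _)]
    have h := hX.count_law B hB hν n
    have h2 : (Nat.cast : ℕ → ℕ∞) ⁻¹' {(n : ℕ∞)} = {n} := by ext; simp
    rw [h2, ← h]
    rfl
  refine Measure.ext_of_singleton fun a => ?_
  induction a using ENat.recTopCoe with
  | coe n => exact hn n
  | top =>
    have h1 : ({⊤} : Set ℕ∞)ᶜ = ⋃ n : ℕ, {(n : ℕ∞)} := by
      ext a
      induction a using ENat.recTopCoe <;> simp
    have h2 : ∀ M : Measure ℕ∞, M ({⊤}ᶜ) = ∑' n : ℕ, M {(n : ℕ∞)} := fun M => by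
      rw [h1, measure_iUnion (fun i j hij => by simpa using hij)
        (fun n => measurableSet_singleton _)]
    have h3 : MeasurableSet ({⊤} : Set ℕ∞)ᶜ := (measurableSet_singleton _).compl
    rw [← compl_compl ({⊤} : Set ℕ∞), prob_compl_eq_one_sub h3, prob_compl_eq_one_sub h3, h2, h2]
    simp_rw [hn]

lemma lintegral_eexp_pointCount [IsProbabilityMeasure P] (hX : IsPoissonPointProcess X ν P)
    {B : Set E} (hB : MeasurableSet B) (hν : ν B ≠ ∞) (c : NNReal) :
    ∫⁻ ω, eexp (c * (pointCount X B ω : ℝ≥0∞)) ∂P = eexp (ν B * (eexp c - 1)) := by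
  have hm := measurable_pointCount hX.measurable_point hB
  have hf : Measurable fun n : ℕ∞ => eexp (c * (n : ℝ≥0∞)) := Measurable.of_discrete
  rw [← lintegral_map (f := fun n : ℕ∞ => eexp (c * (n : ℝ≥0∞))) hf hm, map_pointCount hX hB hν,
    lintegral_map hf measurable_from_top]
  simp_rw [ENat.toENNReal_coe]
  rw [lintegral_eexp_poissonMeasure, ENNReal.coe_toNNReal hν]

/-- The exponential formula for a Poisson process and a step function. -/
lemma lintegral_eexp_tsum_step [IsProbabilityMeasure P] (hX : IsPoissonPointProcess X ν P)
    {n : ℕ} {B : Fin n → Set E} (hB : ∀ j, MeasurableSet (B j)) (hν : ∀ j, ν (B j) ≠ ∞)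
    (hd : Pairwise (fun i j => Disjoint (B i) (B j))) (c : Fin n → NNReal) :
    ∫⁻ ω, eexp (∑' i, ∑ j, (B j).indicator (fun _ => (c j : ℝ≥0∞)) (X i ω)) ∂P =
      eexp (∫⁻ x, eexp (∑ j, (B j).indicator (fun _ => (c j : ℝ≥0∞)) x) - 1 ∂ν) := by
  have hm := fun j => measurable_pointCount hX.measurable_point (hB j)
  have h1 : ∀ ω, eexp (∑' i, ∑ j, (B j).indicator (fun _ => (c j : ℝ≥0∞)) (X i ω)) =
      ∏ j, eexp (c j * (pointCount X (B j) ω : ℝ≥0∞)) := fun ω => by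
    rw [Summable.tsum_finsetSum (fun _ _ => ENNReal.summable), eexp_sum]
    simp_rw [tsum_indicator_pointCount]
  -- By disjointness at most one indicator is nonzero at `x`, so `eexp (·) - 1` acts termwise.
  have h2 : ∀ x, eexp (∑ j, (B j).indicator (fun _ => (c j : ℝ≥0∞)) x) - 1 =
      ∑ j, (B j).indicator (fun _ => eexp (c j) - 1) x := fun x => by
    by_cases hx : ∃ j, x ∈ B j
    · obtain ⟨j, hj⟩ := hx
      have hne : ∀ k, k ≠ j → x ∉ B k := fun k hk hxk =>
        Set.disjoint_left.1 (hd hk) hxk hj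
      rw [Finset.sum_eq_single j, Finset.sum_eq_single j] <;> simp +contextual [hj, hne]
    · push Not at hx
      simp [hx, eexp_zero]
  simp_rw [h1, h2]
  rw [lintegral_prod_eq_prod_lintegral_of_indepFun Finset.univ
      (fun j ω => eexp (c j * (pointCount X (B j) ω : ℝ≥0∞)))
      ((hX.count_indep n B hB hν hd).comp (fun j m => eexp (c j * (m : ℝ≥0∞)))
        (fun j => Measurable.of_discrete))
      (fun j => (Measurable.of_discrete (f := fun m : ℕ∞ => eexp (c j * (m : ℝ≥0∞)))).comp (hm j)),
    lintegral_finsetSum _ (fun j _ => measurable_const.indicator (hB j)), eexp_sum]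
  refine Finset.prod_congr rfl fun j _ => ?_
  rw [lintegral_eexp_pointCount hX (hB j) (hν j), lintegral_indicator_const (hB j), mul_comm]

/-- The nonzero fibres are disjoint sets of finite intensity, which is the step case. The zero fibre
may have infinite intensity, but it contributes nothing to either side. -/
lemma lintegral_eexp_tsum_simpleFunc [IsProbabilityMeasure P] (hX : IsPoissonPointProcess X ν P)
    (φ : SimpleFunc E NNReal) (hφ : ∀ c, c ≠ 0 → ν (φ ⁻¹' {c}) ≠ ∞) :
    ∫⁻ ω, eexp (∑' i, (φ (X i ω) : ℝ≥0∞)) ∂P = eexp (∫⁻ x, eexp (φ x) - 1 ∂ν) := by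
  classical
  set S := φ.range.filter (· ≠ 0)
  let e := S.equivFin.symm
  have h : ∀ x, (φ x : ℝ≥0∞) =
      ∑ j, (φ ⁻¹' {(e j : NNReal)}).indicator (fun _ => ((e j : NNReal) : ℝ≥0∞)) x := fun x => by
    rw [Equiv.sum_comp e (fun s : S => (φ ⁻¹' {(s : NNReal)}).indicator
        (fun _ => ((s : NNReal) : ℝ≥0∞)) x),
      Finset.sum_coe_sort S (fun s : NNReal => (φ ⁻¹' {s}).indicator (fun _ => (s : ℝ≥0∞)) x)]
    by_cases hx : φ x = 0
    · rw [hx]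
      refine (Finset.sum_eq_zero fun s hs => ?_).symm
      have : s ≠ 0 := (Finset.mem_filter.1 hs).2
      simp [hx, this.symm]
    · rw [Finset.sum_eq_single (φ x)]
      · simp
      · intro b _ hb
        simp [hb.symm]
      · intro hn
        exact absurd (Finset.mem_filter.2 ⟨φ.mem_range_self x, hx⟩) hn
  simp_rw [h]
  refine lintegral_eexp_tsum_step hX (fun j => φ.measurableSet_fiber _)
    (fun j => hφ _ (Finset.mem_filter.1 (e j).2).2) (fun i j hij => ?_) _
  refine Disjoint.preimage _ (Set.disjoint_singleton.2 fun h => hij ?_)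
  exact e.injective (Subtype.ext h)

/-- The exponential formula for a Poisson process: `E ∏ exp (f (X i)) = exp (∫ (exp f - 1))`. -/
theorem lintegral_eexp_tsum [IsProbabilityMeasure P] [SigmaFinite ν]
    (hX : IsPoissonPointProcess X ν P) {f : E → ℝ≥0∞} (hf : Measurable f) :
    ∫⁻ ω, eexp (∑' i, f (X i ω)) ∂P = eexp (∫⁻ x, eexp (f x) - 1 ∂ν) := by
  -- Truncating to spanning sets gives the nonzero fibres finite intensity while keeping the
  -- approximation monotone; both sides then pass to the limit by monotone convergence.
  let φ : ℕ → SimpleFunc E NNReal := fun n =>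
    ((SimpleFunc.eapprox f n).map ENNReal.toNNReal).restrict (spanningSets ν n)
  have hφ : ∀ n x, (φ n x : ℝ≥0∞) = (spanningSets ν n).indicator (SimpleFunc.eapprox f n) x := by
    intro n x
    simp only [φ, SimpleFunc.restrict_apply _ (measurableSet_spanningSets ν n), Set.indicator]
    split_ifs
    · simp [ENNReal.coe_toNNReal (SimpleFunc.eapprox_lt_top f n x).ne]
    · simp
  have hmono : ∀ x, Monotone fun n => (φ n x : ℝ≥0∞) := fun x m n hmn => by
    simp only [hφ]
    refine (Set.indicator_le_indicator (SimpleFunc.monotone_eapprox f hmn x)).trans ?_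
    exact Set.indicator_le_indicator_of_subset (monotone_spanningSets ν hmn) (fun _ => zero_le) x
  have hlim : ∀ x, Filter.Tendsto (fun n => (φ n x : ℝ≥0∞)) Filter.atTop (nhds (f x)) := by
    intro x
    refine (SimpleFunc.tendsto_eapprox hf x).congr' ?_
    have hx := mem_spanningSetsIndex ν x
    filter_upwards [Filter.eventually_ge_atTop (spanningSetsIndex ν x)] with n hn
    rw [hφ, Set.indicator_of_mem (monotone_spanningSets ν hn hx)]
  have hfin : ∀ n c, c ≠ 0 → ν (φ n ⁻¹' {c}) ≠ ∞ := fun n c hc => by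
    refine ((measure_mono fun x hx => ?_).trans_lt (measure_spanningSets_lt_top ν n)).ne
    by_contra hn
    have h0 : (φ n x : ℝ≥0∞) = 0 := by rw [hφ, Set.indicator_of_notMem hn]
    exact hc (by simpa [show φ n x = c from hx] using h0)
  have htsum : ∀ ω, Filter.Tendsto (fun n => ∑' i, (φ n (X i ω) : ℝ≥0∞)) Filter.atTop
      (nhds (∑' i, f (X i ω))) := fun ω => by
    -- A sum over points is an integral against counting measure, so monotone convergence applies to
    -- it too.
    simp_rw [← lintegral_count]
    exact lintegral_tendsto_of_tendsto_of_monotone (fun n => Measurable.of_discrete.aemeasurable)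
      (Filter.Eventually.of_forall fun i => hmono _) (Filter.Eventually.of_forall fun i => hlim _)
  have hmeas : ∀ n, Measurable fun x => (φ n x : ℝ≥0∞) := fun n =>
    measurable_coe_nnreal_ennreal.comp (φ n).measurable
  have hL := lintegral_tendsto_of_tendsto_of_monotone (μ := P)
    (f := fun n ω => eexp (∑' i, (φ n (X i ω) : ℝ≥0∞)))
    (F := fun ω => eexp (∑' i, f (X i ω)))
    (fun n => (measurable_eexp.comp (Measurable.tsum fun i =>
      (hmeas n).comp (hX.measurable_point i))).aemeasurable)
    (Filter.Eventually.of_forall fun ω m n hmn =>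
      eexp_mono (ENNReal.tsum_le_tsum fun i => hmono _ hmn))
    (Filter.Eventually.of_forall fun ω => (continuous_eexp.tendsto _).comp (htsum ω))
  have hR := lintegral_tendsto_of_tendsto_of_monotone (μ := ν)
    (f := fun n x => eexp (φ n x) - 1) (F := fun x => eexp (f x) - 1)
    (fun n => ((measurable_eexp.comp (hmeas n)).sub measurable_const).aemeasurable)
    (Filter.Eventually.of_forall fun x m n hmn =>
      tsub_le_tsub_right (eexp_mono (hmono x hmn)) 1)
    (Filter.Eventually.of_forall fun x =>
      ENNReal.Tendsto.sub ((continuous_eexp.tendsto _).comp (hlim x)) tendsto_const_nhds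
        (Or.inr ENNReal.one_ne_top))
  refine tendsto_nhds_unique hL ?_
  simp_rw [lintegral_eexp_tsum_simpleFunc hX (φ _) (hfin _)]
  exact (continuous_eexp.tendsto _).comp hR

end Poisson

/-! ### Tail and Laplace transform of the unit exponential law. -/

section Exponential

lemma ae_pos_expMeasure : ∀ᵐ x ∂(expMeasure 1), 0 < x := by
  rw [ae_iff]
  have : {a : ℝ | ¬0 < a} = Set.Iic 0 := by ext; simp
  rw [this, expMeasure, gammaMeasure, withDensity_apply _ measurableSet_Iic,
    ← Measure.restrict_congr_set Iio_ae_eq_Iic]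
  exact lintegral_exponentialPDF_of_nonpos (r := 1) le_rfl

lemma expMeasure_Ioi {x : ℝ} (hx : 0 ≤ x) :
    expMeasure 1 (Set.Ioi x) = ENNReal.ofReal (Real.exp (-x)) := by
  have := isProbabilityMeasure_expMeasure one_pos
  have h := cdf_expMeasure_eq one_pos x
  rw [cdf_eq_real, if_pos hx] at h
  rw [← Set.compl_Iic, ← ofReal_measureReal, probReal_compl_eq_one_sub measurableSet_Iic, h]
  simp

lemma expMeasure_ofReal_gt (u : ℝ≥0∞) : expMeasure 1 {x | u < ENNReal.ofReal x} = (eexp u)⁻¹ := by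
  induction u with
  | top => simp [eexp_top]
  | coe u =>
    have h : {x : ℝ | (u : ℝ≥0∞) < ENNReal.ofReal x} = Set.Ioi (u : ℝ) := by
      ext x
      rw [← ENNReal.ofReal_coe_nnreal]
      exact ENNReal.ofReal_lt_ofReal_iff_of_nonneg u.coe_nonneg
    rw [h, expMeasure_Ioi u.coe_nonneg, ← ENNReal.ofReal_coe_nnreal, eexp_ofReal u.coe_nonneg,
      ← ENNReal.ofReal_inv_of_pos (Real.exp_pos _), Real.exp_neg]

lemma lintegral_expMeasure {f : ℝ → ℝ≥0∞} (hf : Measurable f) (r : ℝ) :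
    ∫⁻ x, f x ∂(expMeasure r) = ∫⁻ x, exponentialPDF r x * f x := by
  have : Measurable (exponentialPDF r) := (measurable_exponentialPDFReal r).ennreal_ofReal
  exact lintegral_withDensity_eq_lintegral_mul _ this hf

/-- The Laplace transform of the exponential distribution. -/
lemma lintegral_eexp_expMeasure (s : ℝ≥0∞) :
    ∫⁻ x, (eexp (ENNReal.ofReal x * s))⁻¹ ∂(expMeasure 1) = (1 + s)⁻¹ := by
  induction s with
  | top =>
    -- For `s = ∞` the product with `s` is infinite only off `x ≤ 0`, since `0 * ∞ = 0`; that set is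
    -- null.
    rw [lintegral_congr_ae (g := fun _ => 0)]
    · simp
    · filter_upwards [ae_pos_expMeasure] with x hx
      rw [ENNReal.mul_top (by simpa using hx), eexp_top, ENNReal.inv_top]
  | coe s =>
    have hs : (0 : ℝ) < 1 + s := by positivity
    rw [lintegral_expMeasure (by fun_prop)]
    have h : ∀ x, exponentialPDF 1 x * (eexp (ENNReal.ofReal x * s))⁻¹ =
        ENNReal.ofReal (1 + s)⁻¹ * exponentialPDF (1 + s) x := fun x => by
      rcases lt_or_ge x 0 with hx | hx
      · simp [exponentialPDF_of_neg hx]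
      · rw [exponentialPDF_of_nonneg hx, exponentialPDF_of_nonneg hx, ← ENNReal.ofReal_coe_nnreal,
          ← ENNReal.ofReal_mul hx, eexp_ofReal (by positivity),
          ← ENNReal.ofReal_inv_of_pos (Real.exp_pos _), ← ENNReal.ofReal_mul (by positivity),
          ← ENNReal.ofReal_mul (by positivity), ← Real.exp_neg, ← mul_assoc, inv_mul_cancel₀ hs.ne',
          one_mul, one_mul, ← Real.exp_add]
        ring_nf
    simp_rw [h]
    have hm : Measurable (exponentialPDF (1 + s)) :=
      (measurable_exponentialPDFReal _).ennreal_ofReal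
    rw [lintegral_const_mul _ hm, lintegral_exponentialPDF_eq_one hs, mul_one,
      ENNReal.ofReal_inv_of_pos hs, ENNReal.ofReal_add zero_le_one s.coe_nonneg, ENNReal.ofReal_one,
      ENNReal.ofReal_coe_nnreal]

end Exponential

/-! ### Success probability of one slot with fixed interferers. -/

section Slot

variable {Ω : Type*} [MeasurableSpace Ω] {P : Measure Ω}

/-- The Laplace transform at `s` of a Bernoulli variable times a unit exponential variable. -/
noncomputable def thinnedLaplace (p : ℝ) (s : ℝ≥0∞) : ℝ≥0∞ :=
  ENNReal.ofReal (1 - p) + ENNReal.ofReal p * (1 + s)⁻¹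

@[fun_prop]
lemma measurable_thinnedLaplace (p : ℝ) : Measurable (thinnedLaplace p) := by
  unfold thinnedLaplace
  fun_prop

lemma thinnedLaplace_le_one {p : ℝ} (hp0 : 0 ≤ p) (hp1 : p ≤ 1) (s : ℝ≥0∞) :
    thinnedLaplace p s ≤ 1 := by
  have h : (1 + s)⁻¹ ≤ 1 := by simp
  calc thinnedLaplace p s ≤ ENNReal.ofReal (1 - p) + ENNReal.ofReal p * 1 := by
        unfold thinnedLaplace; gcongr
    _ = 1 := by rw [mul_one, ← ENNReal.ofReal_add (by linarith) hp0]; simp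

variable [IsProbabilityMeasure P] {p : ℝ} {H : Ω → ℝ} {T : Ω → Bool}

lemma measure_eq_false (hp0 : 0 ≤ p) (hT : Measurable T)
    (hTp : P {ω | T ω = true} = ENNReal.ofReal p) :
    P {ω | T ω = false} = ENNReal.ofReal (1 - p) := by
  have h : {ω | T ω = false} = {ω | T ω = true}ᶜ := by ext; simp
  have hm : MeasurableSet {ω | T ω = true} := hT (measurableSet_singleton true)
  rw [h, prob_compl_eq_one_sub hm, hTp,
    ENNReal.ofReal_sub _ hp0, ENNReal.ofReal_one]

lemma lintegral_eexp_thinned (hp0 : 0 ≤ p) (hH : Measurable H) (hT : Measurable T)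
    (hHl : P.map H = expMeasure 1) (hTp : P {ω | T ω = true} = ENNReal.ofReal p)
    (hHT : IndepFun H T P) (s : ℝ≥0∞) :
    ∫⁻ ω, (eexp (if T ω = true then ENNReal.ofReal (H ω) * s else 0))⁻¹ ∂P =
      thinnedLaplace p s := by
  let e : Bool → ℝ≥0∞ := fun b => if b = true then 1 else 0
  have h : ∀ ω, (eexp (if T ω = true then ENNReal.ofReal (H ω) * s else 0))⁻¹ =
      {ω | T ω = false}.indicator 1 ω + (eexp (ENNReal.ofReal (H ω) * s))⁻¹ * e (T ω) := by
    intro ω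
    cases hω : T ω <;> simp [hω, e, eexp_zero]
  have he : Measurable e := Measurable.of_discrete
  have hg : Measurable fun x => (eexp (ENNReal.ofReal x * s))⁻¹ := by fun_prop
  have hmF : MeasurableSet {ω | T ω = false} := hT (measurableSet_singleton false)
  have hmT : MeasurableSet {ω | T ω = true} := hT (measurableSet_singleton true)
  have he2 : ∀ ω, e (T ω) = {ω | T ω = true}.indicator 1 ω := fun ω => by
    cases hω : T ω <;> simp [hω, e]
  simp_rw [h]
  rw [lintegral_add_left (measurable_one.indicator hmF), lintegral_indicator_one hmF,
    measure_eq_false hp0 hT hTp,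
    lintegral_mul_eq_lintegral_mul_lintegral_of_indepFun''
      (f := fun ω => (eexp (ENNReal.ofReal (H ω) * s))⁻¹) (g := fun ω => e (T ω))
      (hg.comp hH).aemeasurable
      (he.comp hT).aemeasurable (hHT.comp hg he),
    ← lintegral_map (f := fun x => (eexp (ENNReal.ofReal x * s))⁻¹) hg hH, hHl,
    lintegral_eexp_expMeasure]
  simp_rw [he2]
  rw [lintegral_indicator_one hmT, hTp, thinnedLaplace, mul_comm]

lemma tendsto_inv_eexp_sum (z : ℕ → ℝ≥0∞) :
    Filter.Tendsto (fun n => ∏ i ∈ Finset.range n, (eexp (z i))⁻¹) Filter.atTop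
      (nhds (eexp (∑' i, z i))⁻¹) := by
  have h : ∀ n, ∏ i ∈ Finset.range n, (eexp (z i))⁻¹ = (eexp (∑ i ∈ Finset.range n, z i))⁻¹ := by
    intro n
    rw [eexp_sum, ENNReal.prod_inv_distrib]
    exact fun i _ j _ _ => Or.inl (eexp_ne_zero _)
  simp_rw [h]
  exact ((continuous_inv.comp continuous_eexp).tendsto _).comp (ENNReal.tendsto_nat_tsum z)

lemma inv_eexp_le_one (u : ℝ≥0∞) : (eexp u)⁻¹ ≤ 1 := by simpa using one_le_eexp u

/-- The Laplace transform of a series of independent nonnegative random variables. -/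
lemma lintegral_inv_eexp_tsum {Z : ℕ → Ω → ℝ≥0∞} (hZ : ∀ i, Measurable (Z i))
    (hind : iIndepFun Z P) {z : ℕ → ℝ≥0∞} (hz : ∀ i, ∫⁻ ω, (eexp (Z i ω))⁻¹ ∂P = (eexp (z i))⁻¹) :
    ∫⁻ ω, (eexp (∑' i, Z i ω))⁻¹ ∂P = (eexp (∑' i, z i))⁻¹ := by
  have hm : ∀ i, Measurable fun ω => (eexp (Z i ω))⁻¹ := fun i =>
    (measurable_eexp.comp (hZ i)).inv
  -- The partial products decrease, so the limit is taken by domination with the constant 1.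
  have hL := tendsto_lintegral_of_dominated_convergence (μ := P)
    (F := fun n ω => ∏ i ∈ Finset.range n, (eexp (Z i ω))⁻¹)
    (f := fun ω => (eexp (∑' i, Z i ω))⁻¹) (fun _ => 1)
    (fun n => Finset.measurable_prod _ fun i _ => hm i)
    (fun n => Filter.Eventually.of_forall fun ω =>
      Finset.prod_le_one' fun i _ => inv_eexp_le_one _)
    (by simp) (Filter.Eventually.of_forall fun ω => tendsto_inv_eexp_sum _)
  refine tendsto_nhds_unique hL ?_
  have h : ∀ n, ∫⁻ ω, ∏ i ∈ Finset.range n, (eexp (Z i ω))⁻¹ ∂P =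
      ∏ i ∈ Finset.range n, (eexp (z i))⁻¹ := fun n => by
    rw [lintegral_prod_eq_prod_lintegral_of_indepFun _ (fun i ω => (eexp (Z i ω))⁻¹)
      (hind.comp (fun _ u => (eexp u)⁻¹) fun _ => measurable_eexp.inv) hm]
    exact Finset.prod_congr rfl fun i _ => hz i
  simp_rw [h]
  exact tendsto_inv_eexp_sum z

/-- By Tonelli the independent threshold `I` can be frozen; the exponential tail at its value is
then `(eexp (I ω))⁻¹`, and averaging gives a Laplace transform. -/
lemma measure_active_and_lt (hH : Measurable H) (hT : Measurable T)
    (hHl : P.map H = expMeasure 1) (hTp : P {ω | T ω = true} = ENNReal.ofReal p)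
    (hHT : IndepFun H T P) {I : Ω → ℝ≥0∞} (hI : Measurable I)
    (hind : IndepFun (fun ω => (H ω, T ω)) I P) :
    P {ω | T ω = true ∧ I ω < ENNReal.ofReal (H ω)} =
      ENNReal.ofReal p * ∫⁻ ω, (eexp (I ω))⁻¹ ∂P := by
  let S : Set ((ℝ × Bool) × ℝ≥0∞) := {y | y.1.2 = true ∧ y.2 < ENNReal.ofReal y.1.1}
  have hS : MeasurableSet S := by
    refine MeasurableSet.inter ?_ ?_
    · exact (measurable_snd.comp measurable_fst) (measurableSet_singleton true)
    · exact measurableSet_lt measurable_snd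
        (ENNReal.measurable_ofReal.comp (measurable_fst.comp measurable_fst))
  have hHTm : Measurable fun ω => (H ω, T ω) := hH.prodMk hT
  have h1 : P {ω | T ω = true ∧ I ω < ENNReal.ofReal (H ω)} =
      P.map (fun ω => ((H ω, T ω), I ω)) S := by
    rw [Measure.map_apply (hHTm.prodMk hI) hS]; rfl
  have := Measure.isProbabilityMeasure_map (μ := P) hI.aemeasurable
  have := Measure.isProbabilityMeasure_map (μ := P) hHTm.aemeasurable
  rw [h1, (indepFun_iff_map_prod_eq_prod_map_map hHTm.aemeasurable hI.aemeasurable).1 hind,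
    Measure.prod_apply_symm hS, lintegral_map (measurable_measure_prodMk_right hS) hI,
    ← lintegral_const_mul (f := fun ω => (eexp (I ω))⁻¹) _ (measurable_eexp.comp hI).inv]
  refine lintegral_congr fun ω => ?_
  rw [Measure.map_apply hHTm (measurable_prodMk_right hS)]
  have h2 := hHT.measure_inter_preimage_eq_mul {x | I ω < ENNReal.ofReal x} {true}
    (measurableSet_lt measurable_const (by fun_prop)) (measurableSet_singleton _)
  rw [← Measure.map_apply hH (measurableSet_lt measurable_const (by fun_prop)), hHl,
    expMeasure_ofReal_gt] at h2
  rw [← hTp, mul_comm]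
  refine Eq.trans ?_ h2
  congr 1
  ext ω'
  simp [S, and_comm]

omit [IsProbabilityMeasure P] in
lemma indepFun_none_some {β : Type*} [MeasurableSpace β] {Y : Option ℕ → Ω → β}
    (hY : ∀ j, Measurable (Y j)) (hind : iIndepFun Y P) :
    IndepFun (Y none) (fun ω i => Y (some i) ω) P := by
  have h := indep_iSup_of_disjoint (fun j => (hY j).comap_le) hind.iIndep
    (S := {none}) (T := {none}ᶜ) disjoint_compl_right
  refine indep_of_indep_of_le h ?_ ?_
  · exact le_iSup₂_of_le (f := fun i (_ : i ∈ ({none} : Set (Option ℕ))) =>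
      MeasurableSpace.comap (Y i) inferInstance) none rfl le_rfl
  · rw [← measurable_iff_comap_le]
    refine @measurable_pi_lambda _ _ _ (_) _ _ fun i => ?_
    rw [measurable_iff_comap_le]
    exact le_iSup₂_of_le (f := fun i (_ : i ∈ ({none}ᶜ : Set (Option ℕ))) =>
      MeasurableSpace.comap (Y i) inferInstance) (some i) (by simp) le_rfl

/-- The success probability in one slot for fixed interferers: `a` is the normalized noise and
`s i` the normalized path gain of interferer `i`. -/
lemma measure_slot_success (hp0 : 0 ≤ p) (hp1 : p < 1) {H : Option ℕ → Ω → ℝ}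
    {T : Option ℕ → Ω → Bool} (hH : ∀ j, Measurable (H j)) (hT : ∀ j, Measurable (T j))
    (hHl : ∀ j, P.map (H j) = expMeasure 1) (hTp : ∀ j, P {ω | T j ω = true} = ENNReal.ofReal p)
    (hHT : ∀ j, IndepFun (H j) (T j) P) (hind : iIndepFun (fun j ω => (H j ω, T j ω)) P)
    (a : ℝ≥0∞) (s : ℕ → ℝ≥0∞) :
    P {ω | T none ω = true ∧
      a + ∑' i, (if T (some i) ω = true then ENNReal.ofReal (H (some i) ω) * s i else 0) <
        ENNReal.ofReal (H none ω)} =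
      ENNReal.ofReal p * ((eexp a)⁻¹ * (eexp (∑' i, elog (thinnedLaplace p (s i))⁻¹))⁻¹) := by
  let g : ℕ → ℝ × Bool → ℝ≥0∞ := fun i y => if y.2 = true then ENNReal.ofReal y.1 * s i else 0
  have hg : ∀ i, Measurable (g i) := fun i =>
    Measurable.ite (measurable_snd (measurableSet_singleton true)) (by fun_prop) measurable_const
  have hY : ∀ j, Measurable fun ω => (H j ω, T j ω) := fun j => (hH j).prodMk (hT j)
  have hZ : ∀ i, Measurable fun ω => g i (H (some i) ω, T (some i) ω) := fun i =>
    (hg i).comp (hY _)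
  rw [measure_active_and_lt (hH none) (hT none) (hHl none) (hTp none) (hHT none)
    (I := fun ω => a + ∑' i, g i (H (some i) ω, T (some i) ω))
    (measurable_const.add (Measurable.tsum hZ))]
  · congr 1
    have h1 : ∀ ω, (eexp (a + ∑' i, g i (H (some i) ω, T (some i) ω)))⁻¹ =
        (eexp a)⁻¹ * (eexp (∑' i, g i (H (some i) ω, T (some i) ω)))⁻¹ := fun ω => by
      rw [eexp_add, ENNReal.mul_inv (Or.inl (eexp_ne_zero _)) (Or.inr (eexp_ne_zero _))]
    simp_rw [h1]
    have hm : Measurable fun ω => (eexp (∑' i, g i (H (some i) ω, T (some i) ω)))⁻¹ :=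
      (measurable_eexp.comp (Measurable.tsum hZ)).inv
    rw [lintegral_const_mul _ hm]
    congr 1
    refine lintegral_inv_eexp_tsum hZ
      ((hind.precomp (Option.some_injective ℕ)).comp g hg) fun i => ?_
    -- The factor is at most 1, so its inverse lies in `[1, ∞]`, where `elog` does invert `eexp`.
    rw [eexp_elog (by simpa using thinnedLaplace_le_one hp0 hp1.le _), inv_inv]
    exact lintegral_eexp_thinned hp0 (hH _) (hT _) (hHl _) (hTp _) (hHT _) _
  · exact (indepFun_none_some hY hind).comp measurable_id
      (ψ := fun y : ℕ → ℝ × Bool => a + ∑' i, g i (y i))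
      (measurable_const.add (Measurable.tsum fun i => (hg i).comp (measurable_pi_apply i)))

end Slot

/-! ### Series for the moments of a geometric variable. -/

section Geometric

/-- Cauchy square of the geometric series: the antidiagonal of `n` has `n + 1` elements, each
contributing `r ^ n`. -/
lemma tsum_succ_mul_pow (r : ℝ≥0∞) :
    ∑' n : ℕ, ((n : ℝ≥0∞) + 1) * r ^ n = ((1 - r)⁻¹) ^ 2 := by
  rw [sq, ← ENNReal.tsum_geometric, ← ENNReal.tsum_mul_right]
  simp_rw [← ENNReal.tsum_mul_left]
  rw [← ENNReal.tsum_prod (f := fun i j : ℕ => r ^ i * r ^ j),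
    ← Equiv.tsum_eq Finset.HasAntidiagonal.sigmaAntidiagonalEquivProd
      (fun x : ℕ × ℕ => r ^ x.1 * r ^ x.2), ENNReal.tsum_sigma']
  refine tsum_congr fun n => ?_
  have h : ∀ x : Finset.HasAntidiagonal.antidiagonal n,
      r ^ (Finset.HasAntidiagonal.sigmaAntidiagonalEquivProd ⟨n, x⟩).1 *
        r ^ (Finset.HasAntidiagonal.sigmaAntidiagonalEquivProd ⟨n, x⟩).2 = r ^ n := fun x => by
    rw [← pow_add]
    congr 1
    exact Finset.HasAntidiagonal.mem_antidiagonal.1 x.2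
  simp_rw [h]
  simp

lemma tsum_indicator_lt (N : ℕ∞) :
    ∑' n : ℕ, (if (n : ℕ∞) < N then (1 : ℝ≥0∞) else 0) = N := by
  induction N using ENat.recTopCoe with
  | top => simp
  | coe N =>
    rw [tsum_eq_sum (s := Finset.range N) (fun n hn => by simpa using hn),
      Finset.sum_congr rfl (g := fun _ => 1) (fun n hn => by simpa using hn)]
    simp

lemma tsum_two_mul_succ_indicator_lt (N : ℕ∞) :
    ∑' n : ℕ, 2 * (((n : ℝ≥0∞) + 1) * if (n : ℕ∞) < N then (1 : ℝ≥0∞) else 0) =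
      N ^ 2 + (N : ℝ≥0∞) := by
  induction N using ENat.recTopCoe with
  | top =>
    rw [ENat.toENNReal_top, add_top, eq_top_iff,
      ← ENNReal.tsum_const_eq_top_of_ne_zero (α := ℕ) one_ne_zero]
    refine ENNReal.tsum_le_tsum fun n => ?_
    rw [if_pos (ENat.natCast_lt_top n), mul_one]
    exact one_le_mul one_le_two le_add_self
  | coe N =>
    rw [tsum_eq_sum (s := Finset.range N) (fun n hn => by simpa using hn),
      Finset.sum_congr rfl (g := fun n : ℕ => ((2 * (n + 1) : ℕ) : ℝ≥0∞))
        (fun n hn => by simp [Finset.mem_range.1 hn]), ← Nat.cast_sum, ENat.toENNReal_coe]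
    norm_cast
    induction N with
    | zero => simp
    | succ N ih => rw [Finset.sum_range_succ, ih]; ring

end Geometric

/-! ### Grouping of independent marks and conditionally i.i.d. trials. -/

section Independence

variable {Ω : Type*} [MeasurableSpace Ω] {P : Measure Ω}

/-- Grouping a countable independent family by its first index keeps independence. -/
lemma iIndepFun_curry {ι κ β : Type*} [Countable ι] [Countable κ] [MeasurableSpace β]
    {M : ι × κ → Ω → β} (hM : ∀ i, Measurable (M i)) (hind : iIndepFun M P) :
    iIndepFun (fun i ω j => M (i, j) ω) P := by
  have := hind.isProbabilityMeasure
  have hp : ∀ i, IsProbabilityMeasure (P.map (M i)) := fun i =>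
    Measure.isProbabilityMeasure_map (hM i).aemeasurable
  have hm : ∀ i, Measurable fun ω j => M (i, j) ω := fun i =>
    measurable_pi_lambda _ fun j => hM _
  rw [iIndepFun_iff_map_fun_eq_infinitePi_map hm]
  have h1 : ∀ i, P.map (fun ω j => M (i, j) ω) =
      Measure.infinitePi fun j => P.map (M (i, j)) := fun i =>
    (iIndepFun_iff_map_fun_eq_infinitePi_map fun j => hM (i, j)).1
      (hind.precomp (Prod.mk_right_injective i))
  simp_rw [h1]
  -- Independence says that the joint law is a product measure, and currying carries the product
  -- over `ι × κ` to the iterated product.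
  rw [← Measure.infinitePi_map_curry (fun i j => P.map (M (i, j))),
    ← (iIndepFun_iff_map_fun_eq_infinitePi_map hM).1 hind,
    Measure.map_map (by fun_prop) (measurable_pi_lambda _ hM)]
  rfl

/-- The probability that `n` conditionally i.i.d. trials all fail. -/
lemma measure_forall_notMem [IsProbabilityMeasure P] {α β : Type*} [MeasurableSpace α]
    [MeasurableSpace β] {ξ : Ω → α} {Y : ℕ → Ω → β} (hξ : Measurable ξ) (hY : ∀ k, Measurable (Y k))
    (hind : IndepFun ξ (fun ω k => Y k ω) P) (hYind : iIndepFun Y P) {S : Set (α × β)}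
    (hS : MeasurableSet S) {q : α → ℝ≥0∞} (hq : ∀ k x, P {ω | (x, Y k ω) ∈ S} = q x) (n : ℕ) :
    P {ω | ∀ k < n, (ξ ω, Y k ω) ∉ S} = ∫⁻ ω, (1 - q (ξ ω)) ^ n ∂P := by
  let R : Set (α × (ℕ → β)) := {z | ∀ k < n, (z.1, z.2 k) ∉ S}
  have hR : MeasurableSet R := by
    have : R = ⋂ k ∈ Finset.range n, (fun z : α × (ℕ → β) => (z.1, z.2 k)) ⁻¹' Sᶜ := by
      ext; simp [R]
    rw [this]
    exact Finset.measurableSet_biInter _ fun k _ =>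
      (measurable_fst.prodMk ((measurable_pi_apply k).comp measurable_snd)) hS.compl
  have hYm : Measurable fun ω k => Y k ω := measurable_pi_lambda _ hY
  have := Measure.isProbabilityMeasure_map (μ := P) hξ.aemeasurable
  have := Measure.isProbabilityMeasure_map (μ := P) hYm.aemeasurable
  have hSx : ∀ x, MeasurableSet {y | (x, y) ∈ S} := fun x => measurable_prodMk_left hS
  -- With `ξ` frozen at `x` the `n` failures are independent; integrating over the law of `ξ` then
  -- finishes.
  have h1 : ∀ x, P.map (fun ω k => Y k ω) (Prod.mk x ⁻¹' R) = (1 - q x) ^ n := fun x => by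
    rw [Measure.map_apply hYm (measurable_prodMk_left hR)]
    have h2 : (fun ω k => Y k ω) ⁻¹' (Prod.mk x ⁻¹' R) =
        ⋂ k ∈ Finset.range n, Y k ⁻¹' {y | (x, y) ∈ S}ᶜ := by
      ext; simp [R]
    rw [h2, hYind.meas_biInter (S := Finset.range n) fun k _ => ⟨_, (hSx x).compl, rfl⟩]
    have h3 : ∀ k, P (Y k ⁻¹' {y | (x, y) ∈ S}ᶜ) = 1 - q x := fun k => by
      rw [Set.preimage_compl, prob_compl_eq_one_sub (hY k (hSx x)), ← hq k x]
      rfl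
    rw [Finset.prod_congr rfl fun k _ => h3 k, Finset.prod_const, Finset.card_range]
  have h4 : P {ω | ∀ k < n, (ξ ω, Y k ω) ∉ S} = P.map (fun ω => (ξ ω, fun k => Y k ω)) R := by
    rw [Measure.map_apply (hξ.prodMk hYm) hR]; rfl
  rw [h4, (indepFun_iff_map_prod_eq_prod_map_map hξ.aemeasurable hYm.aemeasurable).1 hind,
    Measure.prod_apply hR, lintegral_map (measurable_measure_prodMk_left hR) hξ]
  simp_rw [h1]

end Independence

/-! ### Moments of a mixed geometric waiting time from its tail. -/

section WaitingTime

variable {Ω : Type*}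

lemma lt_iInf_succ_iff {A : ℕ → Prop} (n : ℕ) :
    (n : ℕ∞) < ⨅ (k : ℕ) (_ : A k), ((k + 1 : ℕ) : ℕ∞) ↔ ∀ k < n, ¬ A k := by
  constructor
  · intro h k hk hA
    have h2 := h.trans_le (iInf₂_le (f := fun (k : ℕ) (_ : A k) => ((k + 1 : ℕ) : ℕ∞)) k hA)
    have h3 : n < k + 1 := by exact_mod_cast h2
    omega
  · intro h
    have h1 : (n : ℕ∞) < ((n + 1 : ℕ) : ℕ∞) := by exact_mod_cast Nat.lt_succ_self n
    refine h1.trans_le (le_iInf₂ fun k hA => ?_)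
    have : n ≤ k := by
      by_contra hk
      exact h k (not_le.1 hk) hA
    exact_mod_cast Nat.succ_le_succ this

variable [MeasurableSpace Ω] {P : Measure Ω} {N : Ω → ℕ∞}

lemma measurable_toENNReal_of_measurableSet_lt (hN : ∀ n : ℕ, MeasurableSet {ω | (n : ℕ∞) < N ω}) :
    Measurable fun ω => (N ω : ℝ≥0∞) := by
  simp_rw [← tsum_indicator_lt]
  exact Measurable.tsum fun n => Measurable.ite (hN n) measurable_const measurable_const

lemma lintegral_ite_lt {n : ℕ} (hN : MeasurableSet {ω | (n : ℕ∞) < N ω}) :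
    ∫⁻ ω, (if (n : ℕ∞) < N ω then (1 : ℝ≥0∞) else 0) ∂P = P {ω | (n : ℕ∞) < N ω} := by
  rw [← lintegral_indicator_one hN]
  refine lintegral_congr fun ω => ?_
  simp [Set.indicator_apply]

/-- Sum the tails, exchange sum and expectation, and sum the geometric series with ratio `1 - Q`.
The case `Q = 0` is covered by `0⁻¹ = ∞`. -/
lemma lintegral_toENNReal_of_tail {Q : Ω → ℝ≥0∞} (hN : ∀ n : ℕ, MeasurableSet {ω | (n : ℕ∞) < N ω})
    (hQ : Measurable Q) (hQ1 : ∀ ω, Q ω ≤ 1)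
    (htail : ∀ n : ℕ, P {ω | (n : ℕ∞) < N ω} = ∫⁻ ω, (1 - Q ω) ^ n ∂P) :
    ∫⁻ ω, (N ω : ℝ≥0∞) ∂P = ∫⁻ ω, (Q ω)⁻¹ ∂P := by
  have h : ∀ n : ℕ, ∫⁻ ω, (if (n : ℕ∞) < N ω then (1 : ℝ≥0∞) else 0) ∂P =
      ∫⁻ ω, (1 - Q ω) ^ n ∂P := fun n => by
    rw [← htail, lintegral_ite_lt (hN n)]
  simp_rw [← tsum_indicator_lt]
  rw [lintegral_tsum fun n =>
    (Measurable.ite (hN n) measurable_const measurable_const).aemeasurable]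
  simp_rw [h]
  rw [← lintegral_tsum fun n => by fun_prop]
  refine lintegral_congr fun ω => ?_
  rw [ENNReal.tsum_geometric, ENNReal.sub_sub_cancel ENNReal.one_ne_top (hQ1 ω)]

/-- The combination `N² + N` is the sum of `2(n + 1)` over `n < N`, so its tail series has the
closed form 2/Q²; it avoids subtraction in `ℝ≥0∞`. -/
lemma lintegral_sq_add_toENNReal_of_tail {Q : Ω → ℝ≥0∞}
    (hN : ∀ n : ℕ, MeasurableSet {ω | (n : ℕ∞) < N ω})
    (hQ : Measurable Q) (hQ1 : ∀ ω, Q ω ≤ 1)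
    (htail : ∀ n : ℕ, P {ω | (n : ℕ∞) < N ω} = ∫⁻ ω, (1 - Q ω) ^ n ∂P) :
    ∫⁻ ω, ((N ω : ℝ≥0∞) ^ 2 + (N ω : ℝ≥0∞)) ∂P = 2 * ∫⁻ ω, ((Q ω)⁻¹) ^ 2 ∂P := by
  have hm : ∀ n : ℕ, Measurable fun ω => if (n : ℕ∞) < N ω then (1 : ℝ≥0∞) else 0 := fun n =>
    Measurable.ite (hN n) measurable_const measurable_const
  have h : ∀ n : ℕ, ∫⁻ ω, 2 * (((n : ℝ≥0∞) + 1) * if (n : ℕ∞) < N ω then (1 : ℝ≥0∞) else 0) ∂P =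
      ∫⁻ ω, 2 * (((n : ℝ≥0∞) + 1) * (1 - Q ω) ^ n) ∂P := fun n => by
    rw [lintegral_const_mul _ ((hm n).const_mul _), lintegral_const_mul _ (hm n),
      lintegral_const_mul _ (by fun_prop), lintegral_const_mul _ (by fun_prop),
      ← htail, lintegral_ite_lt (hN n)]
  simp_rw [← tsum_two_mul_succ_indicator_lt]
  rw [lintegral_tsum fun n => (((hm n).const_mul _).const_mul _).aemeasurable]
  simp_rw [h]
  rw [← lintegral_tsum fun n => by fun_prop, ← lintegral_const_mul _ (by fun_prop)]
  refine lintegral_congr fun ω => ?_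
  rw [ENNReal.tsum_mul_left, tsum_succ_mul_pow,
    ENNReal.sub_sub_cancel ENNReal.one_ne_top (hQ1 ω)]

end WaitingTime

/-! ### Radial integrals through the Gamma function. -/

section Integrals

lemma lintegral_ofReal_of_integral_eq {α : Type*} [MeasurableSpace α] {μ : Measure α} {f : α → ℝ}
    {c : ℝ} (hf : 0 ≤ᵐ[μ] f) (h : ∫ x, f x ∂μ = c) (hc : c ≠ 0) :
    ∫⁻ x, ENNReal.ofReal (f x) ∂μ = ENNReal.ofReal c := by
  rw [← h, ofReal_integral_eq_lintegral_ofReal (.of_integral_ne_zero (h ▸ hc)) hf]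

lemma lintegral_rpow_mul_exp_neg_mul {m y : ℝ} (hm : 0 < m) (hy : 0 < y) :
    ∫⁻ t in Set.Ioi (0 : ℝ), ENNReal.ofReal (t ^ (m - 1) * Real.exp (-(y * t))) =
      ENNReal.ofReal ((1 / y) ^ m * Real.Gamma m) := by
  refine lintegral_ofReal_of_integral_eq ?_ (Real.integral_rpow_mul_exp_neg_mul_Ioi hm hy) ?_
  · filter_upwards [ae_restrict_mem measurableSet_Ioi] with t ht
    have : (0 : ℝ) < t := ht
    simp only [Pi.zero_apply]
    positivity
  · have := Real.Gamma_pos_of_pos hm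
    positivity

variable {d : ℕ} {α : ℝ}

lemma lintegral_exp_neg_mul_norm_rpow (hd : 1 ≤ d) (hα : 0 < α) {t : ℝ} (ht : 0 < t) :
    ∫⁻ x : EuclideanSpace ℝ (Fin d), ENNReal.ofReal (Real.exp (-(t * ‖x‖ ^ α))) =
      ENNReal.ofReal (volume.real (Metric.ball (0 : EuclideanSpace ℝ (Fin d)) 1) *
        (d / α * Real.Gamma (d / α)) * t ^ (-(d / α))) := by
  have hd' : (0 : ℝ) < d := by exact_mod_cast hd
  have : Nonempty (Fin d) := ⟨⟨0, hd⟩⟩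
  have hv : 0 < volume.real (Metric.ball (0 : EuclideanSpace ℝ (Fin d)) 1) :=
    ENNReal.toReal_pos (Metric.measure_ball_pos _ _ one_pos).ne' measure_ball_lt_top.ne
  have hG := Real.Gamma_pos_of_pos (div_pos hd' hα)
  refine lintegral_ofReal_of_integral_eq (Filter.Eventually.of_forall fun x => (Real.exp_pos _).le)
    ?_ (by positivity)
  rw [integral_fun_norm_addHaar volume (fun y => Real.exp (-(t * y ^ α))), finrank_euclideanSpace,
    Fintype.card_fin]
  have h1 : ∫ y in Set.Ioi (0 : ℝ), y ^ (d - 1) • Real.exp (-(t * y ^ α)) =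
      ∫ y in Set.Ioi (0 : ℝ), y ^ ((d : ℝ) - 1) * Real.exp (-t * y ^ α) := by
    refine setIntegral_congr_fun measurableSet_Ioi fun y _ => ?_
    simp only [smul_eq_mul, neg_mul]
    rw [← Real.rpow_natCast, Nat.cast_sub hd, Nat.cast_one]
  rw [h1, integral_rpow_mul_exp_neg_mul_rpow hα (by linarith) ht]
  simp only [sub_add_cancel, nsmul_eq_mul, smul_eq_mul, neg_div]
  ring

/-- The integral of `(‖x‖ ^ α + a) ^ (-m)` over `ℝ ^ d`. -/
lemma lintegral_inv_norm_rpow_add_rpow (hd : 1 ≤ d) (hα : (d : ℝ) < α) {a m : ℝ} (ha : 0 < a)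
    (hm : 1 ≤ m) :
    ∫⁻ x : EuclideanSpace ℝ (Fin d),
        ENNReal.ofReal ((1 / (‖x‖ ^ α + a)) ^ m * Real.Gamma m) =
      ENNReal.ofReal (volume.real (Metric.ball (0 : EuclideanSpace ℝ (Fin d)) 1) *
        (d / α * Real.Gamma (d / α)) * ((1 / a) ^ (m - d / α) * Real.Gamma (m - d / α))) := by
  have hd' : (0 : ℝ) < d := by exact_mod_cast hd
  have hα0 : 0 < α := hd'.trans hα
  have hδ : (d : ℝ) / α < 1 := (div_lt_one hα0).2 hα
  have hG := Real.Gamma_pos_of_pos (div_pos hd' hα0)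
  have h1 : ∀ x : EuclideanSpace ℝ (Fin d),
      ENNReal.ofReal ((1 / (‖x‖ ^ α + a)) ^ m * Real.Gamma m) =
        ∫⁻ t in Set.Ioi (0 : ℝ),
          ENNReal.ofReal (t ^ (m - 1) * Real.exp (-((‖x‖ ^ α + a) * t))) := fun x =>
    (lintegral_rpow_mul_exp_neg_mul (by linarith) (by positivity)).symm
  simp_rw [h1]
  -- With the power written as a Gamma integral in `t`, Tonelli leaves a stretched Gaussian in `x`,
  -- whose mass scales as `t ^ (-d/α)`, and then a Gamma integral of order `m - d/α`.
  rw [lintegral_lintegral_swap (by fun_prop)]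
  have h2 : ∀ t ∈ Set.Ioi (0 : ℝ), ∫⁻ x : EuclideanSpace ℝ (Fin d),
      ENNReal.ofReal (t ^ (m - 1) * Real.exp (-((‖x‖ ^ α + a) * t))) =
      ENNReal.ofReal (volume.real (Metric.ball (0 : EuclideanSpace ℝ (Fin d)) 1) *
        (d / α * Real.Gamma (d / α))) *
        ENNReal.ofReal (t ^ (m - d / α - 1) * Real.exp (-(a * t))) := fun t ht => by
    have ht' : (0 : ℝ) < t := ht
    have h3 : ∀ x : EuclideanSpace ℝ (Fin d),
        ENNReal.ofReal (t ^ (m - 1) * Real.exp (-((‖x‖ ^ α + a) * t))) =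
          ENNReal.ofReal (t ^ (m - 1) * Real.exp (-(a * t))) *
            ENNReal.ofReal (Real.exp (-(t * ‖x‖ ^ α))) := fun x => by
      rw [← ENNReal.ofReal_mul (by positivity), mul_assoc, ← Real.exp_add]
      ring_nf
    simp_rw [h3]
    rw [lintegral_const_mul _ (by fun_prop), lintegral_exp_neg_mul_norm_rpow hd hα0 ht',
      ← ENNReal.ofReal_mul (by positivity), ← ENNReal.ofReal_mul (by positivity)]
    congr 1
    rw [show m - d / α - 1 = (m - 1) + -(d / α) by ring, Real.rpow_add ht']
    ring
  rw [setLIntegral_congr_fun measurableSet_Ioi h2, lintegral_const_mul _ (by fun_prop),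
    lintegral_rpow_mul_exp_neg_mul (by linarith) ha, ← ENNReal.ofReal_mul (by positivity)]

/-- Euler's reflection formula. `Real.sinc` is the unnormalized sin x / x, so the right side is πδ /
sin(πδ). -/
lemma mul_Gamma_mul_Gamma_one_sub {δ : ℝ} (hδ : 0 < δ) :
    δ * Real.Gamma δ * Real.Gamma (1 - δ) = 1 / Real.sinc (Real.pi * δ) := by
  rw [mul_assoc, Real.Gamma_mul_Gamma_one_sub, Real.sinc_of_ne_zero (by positivity), one_div_div]
  ring

lemma lintegral_inv_norm_rpow_add (hd : 1 ≤ d) (hα : (d : ℝ) < α) {a : ℝ} (ha : 0 < a) :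
    ∫⁻ x : EuclideanSpace ℝ (Fin d), ENNReal.ofReal (1 / (‖x‖ ^ α + a)) =
      ENNReal.ofReal (volume.real (Metric.ball (0 : EuclideanSpace ℝ (Fin d)) 1) *
        (1 / Real.sinc (Real.pi * (d / α))) * (1 / a) ^ (1 - d / α)) := by
  have hd' : (0 : ℝ) < d := by exact_mod_cast hd
  have h := lintegral_inv_norm_rpow_add_rpow hd hα ha le_rfl
  simp only [Real.rpow_one, Real.Gamma_one, mul_one] at h
  rw [h, ← mul_Gamma_mul_Gamma_one_sub (div_pos hd' (hd'.trans hα))]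
  congr 1
  ring

lemma lintegral_inv_norm_rpow_add_sq (hd : 1 ≤ d) (hα : (d : ℝ) < α) {a : ℝ} (ha : 0 < a) :
    ∫⁻ x : EuclideanSpace ℝ (Fin d), ENNReal.ofReal ((1 / (‖x‖ ^ α + a)) ^ 2) =
      ENNReal.ofReal (volume.real (Metric.ball (0 : EuclideanSpace ℝ (Fin d)) 1) *
        (1 / Real.sinc (Real.pi * (d / α))) * ((1 - d / α) * (1 / a) ^ (2 - d / α))) := by
  have hd' : (0 : ℝ) < d := by exact_mod_cast hd
  have hα0 : 0 < α := hd'.trans hα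
  have hδ : (d : ℝ) / α < 1 := (div_lt_one hα0).2 hα
  have h := lintegral_inv_norm_rpow_add_rpow hd hα ha one_le_two
  simp only [Real.rpow_two, Real.Gamma_two, mul_one] at h
  rw [h, ← mul_Gamma_mul_Gamma_one_sub (div_pos hd' hα0),
    show (2 : ℝ) - d / α = (1 - d / α) + 1 by ring, Real.Gamma_add_one (by linarith)]
  congr 1
  ring

end Integrals

/-! ### The factor contributed by one interferer. -/

section PathGain

variable {d : ℕ} {α : ℝ}

/-- The path gain `‖x‖ ^ (-α)`, scaled by `c`. -/
noncomputable def scaledGain (α c : ℝ) (x : EuclideanSpace ℝ (Fin d)) : ℝ≥0∞ :=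
  ENNReal.ofReal c * ‖x‖ₑ ^ (-α)

@[fun_prop]
lemma measurable_scaledGain (α c : ℝ) :
    Measurable (scaledGain α c : EuclideanSpace ℝ (Fin d) → ℝ≥0∞) := by
  unfold scaledGain
  fun_prop

/-- With y = ‖x‖^α, the Laplace factor is (y + (1-p)c) / (y + c). Its inverse is 1 plus a multiple
of 1 / (y + (1-p)c), the integrand evaluated above. -/
lemma thinnedLaplace_scaledGain_inv {p c : ℝ} (hp0 : 0 ≤ p) (hp1 : p < 1) (hc : 0 < c)
    {x : EuclideanSpace ℝ (Fin d)} (hx : x ≠ 0) :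
    (thinnedLaplace p (scaledGain α c x))⁻¹ =
      ENNReal.ofReal (1 + p * c * (1 / (‖x‖ ^ α + (1 - p) * c))) := by
  have hx' : 0 < ‖x‖ := norm_pos_iff.2 hx
  have hy : 0 < ‖x‖ ^ α := by positivity
  have hq : 0 < 1 - p := by linarith
  have hs : scaledGain α c x = ENNReal.ofReal (c / ‖x‖ ^ α) := by
    rw [scaledGain, ← ofReal_norm, ENNReal.ofReal_rpow_of_pos hx', ← ENNReal.ofReal_mul hc.le,
      Real.rpow_neg hx'.le, div_eq_mul_inv]
  rw [hs, thinnedLaplace, ← ENNReal.ofReal_one, ← ENNReal.ofReal_add zero_le_one (by positivity),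
    ← ENNReal.ofReal_inv_of_pos (by positivity), ← ENNReal.ofReal_mul hp0,
    ← ENNReal.ofReal_add hq.le (by positivity), ← ENNReal.ofReal_inv_of_pos (by positivity)]
  congr 1
  generalize ‖x‖ ^ α = y at *
  have h1 : 0 < y + (1 - p) * c := by positivity
  have h2 : 1 - p + p * (1 + c / y)⁻¹ = (y + (1 - p) * c) / (y + c) := by
    field_simp
    ring
  rw [h2]
  field_simp
  ring

end PathGain

/-! ### The two exponents in the exponential formula. -/

section Exponents

lemma ae_ne_zero_euclideanSpace {d : ℕ} (hd : 1 ≤ d) :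
    ∀ᵐ x : EuclideanSpace ℝ (Fin d), x ≠ 0 := by
  have : Nonempty (Fin d) := ⟨⟨0, hd⟩⟩
  exact compl_mem_ae_iff.2 (measure_singleton 0)

variable {d : ℕ} {α p c : ℝ}

lemma eexp_elog_inv_thinnedLaplace (hp0 : 0 ≤ p) (hp1 : p ≤ 1) (s : ℝ≥0∞) :
    eexp (elog (thinnedLaplace p s)⁻¹) = (thinnedLaplace p s)⁻¹ :=
  eexp_elog (by simpa using thinnedLaplace_le_one hp0 hp1 s)

lemma lintegral_inv_thinnedLaplace_sub_one (hd : 1 ≤ d) (hα : (d : ℝ) < α) (hp0 : 0 < p)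
    (hp1 : p < 1) (hc : 0 < c) :
    ∫⁻ x : EuclideanSpace ℝ (Fin d),
        eexp (elog (thinnedLaplace p (scaledGain α c x))⁻¹) - 1 =
      ENNReal.ofReal (p * c * (volume.real (Metric.ball (0 : EuclideanSpace ℝ (Fin d)) 1) *
        (1 / Real.sinc (Real.pi * (d / α))) * (1 / ((1 - p) * c)) ^ (1 - d / α))) := by
  have ha : 0 < (1 - p) * c := mul_pos (by linarith) hc
  have h : ∀ᵐ x : EuclideanSpace ℝ (Fin d),
      eexp (elog (thinnedLaplace p (scaledGain α c x))⁻¹) - 1 =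
        ENNReal.ofReal (p * c) * ENNReal.ofReal (1 / (‖x‖ ^ α + (1 - p) * c)) := by
    filter_upwards [ae_ne_zero_euclideanSpace hd] with x hx
    rw [eexp_elog_inv_thinnedLaplace hp0.le hp1.le,
      thinnedLaplace_scaledGain_inv hp0.le hp1 hc hx, ← ENNReal.ofReal_one,
      ← ENNReal.ofReal_sub _ zero_le_one, ← ENNReal.ofReal_mul (by positivity)]
    congr 1
    ring
  rw [lintegral_congr_ae h, lintegral_const_mul _ (by fun_prop),
    lintegral_inv_norm_rpow_add hd hα ha, ← ENNReal.ofReal_mul (by positivity)]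

/-- Writing the inverse factor as 1 + u, the integrand is 2u + u², which calls for both the first
and the second power integrals. -/
lemma lintegral_inv_thinnedLaplace_sq_sub_one (hd : 1 ≤ d) (hα : (d : ℝ) < α) (hp0 : 0 < p)
    (hp1 : p < 1) (hc : 0 < c) :
    ∫⁻ x : EuclideanSpace ℝ (Fin d),
        eexp (2 * elog (thinnedLaplace p (scaledGain α c x))⁻¹) - 1 =
      ENNReal.ofReal (2 * (p * c) * (volume.real (Metric.ball (0 : EuclideanSpace ℝ (Fin d)) 1) *
          (1 / Real.sinc (Real.pi * (d / α))) * (1 / ((1 - p) * c)) ^ (1 - d / α)) +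
        (p * c) ^ 2 * (volume.real (Metric.ball (0 : EuclideanSpace ℝ (Fin d)) 1) *
          (1 / Real.sinc (Real.pi * (d / α))) *
          ((1 - d / α) * (1 / ((1 - p) * c)) ^ (2 - d / α)))) := by
  have ha : 0 < (1 - p) * c := mul_pos (by linarith) hc
  have hd' : (0 : ℝ) < d := by exact_mod_cast hd
  have hα0 : 0 < α := hd'.trans hα
  have hδ : 0 < 1 - (d : ℝ) / α := sub_pos.2 ((div_lt_one hα0).2 hα)
  have hκ : 0 < 1 / Real.sinc (Real.pi * (d / α)) := by
    rw [← mul_Gamma_mul_Gamma_one_sub (by positivity)]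
    have := Real.Gamma_pos_of_pos hδ
    have := Real.Gamma_pos_of_pos (div_pos hd' hα0)
    positivity
  have h : ∀ᵐ x : EuclideanSpace ℝ (Fin d),
      eexp (2 * elog (thinnedLaplace p (scaledGain α c x))⁻¹) - 1 =
        ENNReal.ofReal (2 * (p * c)) * ENNReal.ofReal (1 / (‖x‖ ^ α + (1 - p) * c)) +
        ENNReal.ofReal ((p * c) ^ 2) * ENNReal.ofReal ((1 / (‖x‖ ^ α + (1 - p) * c)) ^ 2) := by
    filter_upwards [ae_ne_zero_euclideanSpace hd] with x hx
    rw [two_mul, eexp_add, eexp_elog_inv_thinnedLaplace hp0.le hp1.le,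
      thinnedLaplace_scaledGain_inv hp0.le hp1 hc hx, ← ENNReal.ofReal_mul (by positivity),
      ← ENNReal.ofReal_one, ← ENNReal.ofReal_sub _ zero_le_one,
      ← ENNReal.ofReal_mul (by positivity), ← ENNReal.ofReal_mul (by positivity),
      ← ENNReal.ofReal_add (by positivity) (by positivity)]
    congr 1
    ring
  rw [lintegral_congr_ae h, lintegral_add_left (by fun_prop), lintegral_const_mul _ (by fun_prop),
    lintegral_const_mul _ (by fun_prop), lintegral_inv_norm_rpow_add hd hα ha,
    lintegral_inv_norm_rpow_add_sq hd hα ha, ← ENNReal.ofReal_mul (by positivity),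
    ← ENNReal.ofReal_mul (by positivity), ← ENNReal.ofReal_add (by positivity) (by positivity)]

/-- The powers of c = θ r^α combine to c^(d/α) = r^d θ^(d/α), whatever `n` is; the cases 1 and 2
serve the two moments. -/
lemma pow_mul_inv_rpow_sub {θ r q : ℝ} (hθ : 0 < θ) (hr : 0 < r) (hq : 0 < q) (hα : 0 < α) (n : ℕ) :
    (θ * r ^ α) ^ n * (1 / (q * (θ * r ^ α))) ^ ((n : ℝ) - d / α) =
      r ^ d * θ ^ ((d : ℝ) / α) / q ^ ((n : ℝ) - d / α) := by
  have hc : 0 < θ * r ^ α := by positivity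
  rw [one_div, Real.inv_rpow (by positivity), Real.mul_rpow hq.le hc.le]
  have h1 : (θ * r ^ α) ^ ((n : ℝ) - d / α) = (θ * r ^ α) ^ n / (r ^ d * θ ^ ((d : ℝ) / α)) := by
    rw [Real.rpow_sub hc, Real.rpow_natCast, Real.mul_rpow hθ.le (by positivity),
      ← Real.rpow_mul hr.le, mul_div_cancel₀ _ hα.ne', Real.rpow_natCast, mul_comm (θ ^ _)]
  rw [h1]
  have : q ^ ((n : ℝ) - d / α) ≠ 0 := (Real.rpow_pos_of_pos hq _).ne'
  field_simp

end Exponents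

/-! ### From extended expectations to real mean and variance. -/

section Moments

variable {Ω : Type*} [MeasurableSpace Ω] {P : Measure Ω} [IsProbabilityMeasure P] {N : Ω → ℕ∞}

lemma moments_of_lintegral {m₁ m₂ : ℝ} (hN : Measurable fun ω => (N ω : ℝ≥0∞)) (hm₁ : 0 ≤ m₁)
    (hm₂ : 0 ≤ m₂) (h₁ : ∫⁻ ω, (N ω : ℝ≥0∞) ∂P = ENNReal.ofReal m₁)
    (h₂ : ∫⁻ ω, ((N ω : ℝ≥0∞) ^ 2 + (N ω : ℝ≥0∞)) ∂P = ENNReal.ofReal m₂) :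
    (∀ᵐ ω ∂P, N ω ≠ ⊤) ∧ MemLp (fun ω => ((N ω).toNat : ℝ)) 2 P ∧
      ∫ ω, ((N ω).toNat : ℝ) ∂P = m₁ ∧
      variance (fun ω => ((N ω).toNat : ℝ)) P = m₂ - m₁ - m₁ ^ 2 := by
  -- Both conversions send `⊤` to 0, so this holds everywhere, before finiteness is known.
  have hX : ∀ ω, ((N ω).toNat : ℝ) = (N ω : ℝ≥0∞).toReal := fun ω => by
    cases N ω using ENat.recTopCoe <;> simp
  simp_rw [hX]
  have hfin : ∀ᵐ ω ∂P, (N ω : ℝ≥0∞) < ∞ := ae_lt_top hN (h₁ ▸ ENNReal.ofReal_ne_top)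
  rw [lintegral_add_right _ hN, h₁] at h₂
  have hsq : ∫⁻ ω, (N ω : ℝ≥0∞) ^ 2 ∂P ≠ ∞ := fun h => by simp [h] at h₂
  have hmean : ∫ ω, (N ω : ℝ≥0∞).toReal ∂P = m₁ := by
    rw [integral_toReal hN.aemeasurable hfin, h₁, ENNReal.toReal_ofReal hm₁]
  have hsecond : ∫ ω, (N ω : ℝ≥0∞).toReal ^ 2 ∂P = m₂ - m₁ := by
    simp_rw [← ENNReal.toReal_pow]
    rw [integral_toReal (hN.pow_const 2).aemeasurable
      (hfin.mono fun ω hω => ENNReal.pow_lt_top hω)]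
    have h := congrArg ENNReal.toReal h₂
    rw [ENNReal.toReal_add hsq ENNReal.ofReal_ne_top, ENNReal.toReal_ofReal hm₁,
      ENNReal.toReal_ofReal hm₂] at h
    linarith
  have hLp : MemLp (fun ω => (N ω : ℝ≥0∞).toReal) 2 P := by
    rw [memLp_two_iff_integrable_sq hN.ennreal_toReal.aestronglyMeasurable]
    simp_rw [← ENNReal.toReal_pow]
    exact integrable_toReal_of_lintegral_ne_top (hN.pow_const 2).aemeasurable hsq
  refine ⟨hfin.mono fun ω hω => by simpa using hω.ne, hLp, hmean, ?_⟩
  rw [variance_eq_sub hLp, hmean]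
  simp only [Pi.pow_apply, hsecond]

end Moments

/-! ### Delay in the bipolar network. -/

section Network

variable {Ω : Type*} [MeasurableSpace Ω] {P : Measure Ω} {d : ℕ}
  {lam α θ W N₀ p : ℝ} {x₀ : EuclideanSpace ℝ (Fin d)}
  {X : ℕ → Ω → EuclideanSpace ℝ (Fin d)} {h : ℕ → Option ℕ → Ω → ℝ} {t : ℕ → Option ℕ → Ω → Bool}

/-- The configurations of interferers and marks of one slot for which this slot is successful:
`b` is the normalized noise and `c` the scale of the path gains. -/
def successSet (α b c : ℝ) :
    Set ((ℕ → EuclideanSpace ℝ (Fin d)) × (Option ℕ → ℝ × Bool)) :=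
  {z | (z.2 none).2 = true ∧
    ENNReal.ofReal b + ∑' i, (if (z.2 (some i)).2 = true then
      ENNReal.ofReal (z.2 (some i)).1 * scaledGain α c (z.1 i) else 0) <
        ENNReal.ofReal (z.2 none).1}

lemma measurableSet_successSet (α b c : ℝ) : MeasurableSet (successSet (d := d) α b c) := by
  have h2 : ∀ j : Option ℕ, Measurable
      fun z : (ℕ → EuclideanSpace ℝ (Fin d)) × (Option ℕ → ℝ × Bool) => (z.2 j).2 := by
    intro j; fun_prop
  have h1 : ∀ j : Option ℕ, Measurable
      fun z : (ℕ → EuclideanSpace ℝ (Fin d)) × (Option ℕ → ℝ × Bool) =>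
        ENNReal.ofReal (z.2 j).1 := by
    intro j; fun_prop
  refine MeasurableSet.inter (h2 none (measurableSet_singleton true)) ?_
  have h3 : Measurable fun z : (ℕ → EuclideanSpace ℝ (Fin d)) × (Option ℕ → ℝ × Bool) =>
      ∑' i, (if (z.2 (some i)).2 = true then
        ENNReal.ofReal (z.2 (some i)).1 * scaledGain α c (z.1 i) else 0) :=
    Measurable.tsum fun i => Measurable.ite (h2 (some i) (measurableSet_singleton true))
      ((h1 _).mul (by fun_prop)) measurable_const
  exact measurableSet_lt (measurable_const.add h3) (h1 none)

omit [MeasurableSpace Ω] in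
lemma success_iff_mem_successSet (hθ : 0 < θ) (hx₀ : 0 < ‖x₀‖) (k : ℕ) (ω : Ω) :
    Success α W N₀ θ x₀ X h t k ω ↔
      ((fun i => X i ω, fun j => (h k j ω, t k j ω)) :
        (ℕ → EuclideanSpace ℝ (Fin d)) × (Option ℕ → ℝ × Bool)) ∈
        successSet α (θ * ‖x₀‖ ^ α * W * N₀) (θ * ‖x₀‖ ^ α) := by
  have hc : 0 < θ * ‖x₀‖ ^ α := by positivity
  have hg : ‖x₀‖ₑ ^ (-α) = ENNReal.ofReal (‖x₀‖ ^ (-α)) := by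
    rw [← ofReal_norm, ENNReal.ofReal_rpow_of_pos hx₀]
  have hg0 : 0 < ‖x₀‖ ^ (-α) := by positivity
  have hdiv : θ / ‖x₀‖ ^ (-α) = θ * ‖x₀‖ ^ α := by
    rw [Real.rpow_neg hx₀.le, div_inv_eq_mul]
  have hθ' : ENNReal.ofReal θ ≠ 0 := by simpa using hθ
  refine and_congr Iff.rfl ?_
  -- Clearing the denominator is legitimate even when it is 0 or `∞`, because the threshold is
  -- neither. Dividing by the gain of the desired link then isolates its fading.
  rw [sinr, receivedPower, hg,
    ENNReal.lt_div_iff_mul_lt (Or.inr ENNReal.ofReal_ne_top) (Or.inr hθ'),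
    ← ENNReal.div_lt_iff (Or.inl (by simpa using hg0)) (Or.inl ENNReal.ofReal_ne_top),
    mul_comm (ENNReal.ofReal θ), mul_div_assoc, ← ENNReal.ofReal_div_of_pos hg0, hdiv, add_mul,
    ← ENNReal.ofReal_mul' hc.le, interference, ← ENNReal.tsum_mul_right]
  have h1 : W * N₀ * (θ * ‖x₀‖ ^ α) = θ * ‖x₀‖ ^ α * W * N₀ := by ring
  have h2 : ∀ i, (if t k (some i) ω = true then receivedPower α (h k (some i) ω) (X i ω) else 0) *
      ENNReal.ofReal (θ * ‖x₀‖ ^ α) = if t k (some i) ω = true then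
        ENNReal.ofReal (h k (some i) ω) * scaledGain α (θ * ‖x₀‖ ^ α) (X i ω) else 0 := fun i => by
    split_ifs
    · rw [receivedPower, scaledGain]; ring
    · simp
  simp_rw [h1, h2]

/-- The conditional success probability of a slot given the interferers. -/
noncomputable def slotSuccessProb (α b c p : ℝ) (x : ℕ → EuclideanSpace ℝ (Fin d)) : ℝ≥0∞ :=
  ENNReal.ofReal p * ((eexp (ENNReal.ofReal b))⁻¹ *
    (eexp (∑' i, elog (thinnedLaplace p (scaledGain α c (x i)))⁻¹))⁻¹)

lemma measurable_slotSuccessProb (α b c p : ℝ) :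
    Measurable (slotSuccessProb (d := d) α b c p) := by
  have : Measurable fun x : ℕ → EuclideanSpace ℝ (Fin d) =>
      ∑' i, elog (thinnedLaplace p (scaledGain α c (x i)))⁻¹ :=
    Measurable.tsum fun i => measurable_elog.comp
      ((measurable_thinnedLaplace p).comp
        ((measurable_scaledGain α c).comp (measurable_pi_apply i))).inv
  exact ((measurable_eexp.comp this).inv.const_mul _).const_mul _

lemma slotSuccessProb_le_one (hp1 : p ≤ 1) (b c : ℝ) (x : ℕ → EuclideanSpace ℝ (Fin d)) :
    slotSuccessProb α b c p x ≤ 1 :=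
  mul_le_one' (by simpa using hp1) (mul_le_one' (inv_eexp_le_one _) (inv_eexp_le_one _))

lemma inv_slotSuccessProb (hp0 : 0 < p) {b : ℝ} (hb : 0 ≤ b) (c : ℝ)
    (x : ℕ → EuclideanSpace ℝ (Fin d)) :
    (slotSuccessProb α b c p x)⁻¹ = ENNReal.ofReal (1 / p * Real.exp b) *
      eexp (∑' i, elog (thinnedLaplace p (scaledGain α c (x i)))⁻¹) := by
  have h1 : (eexp (ENNReal.ofReal b))⁻¹ ≠ ∞ := ENNReal.inv_ne_top.2 (eexp_ne_zero _)
  have h2 : (eexp (ENNReal.ofReal b))⁻¹ ≠ 0 := by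
    rw [eexp_ofReal hb]
    exact ENNReal.inv_ne_zero.2 ENNReal.ofReal_ne_top
  rw [slotSuccessProb,
    ENNReal.mul_inv (Or.inl (by simpa using hp0)) (Or.inl ENNReal.ofReal_ne_top),
    ENNReal.mul_inv (Or.inl h2) (Or.inl h1), inv_inv, inv_inv, eexp_ofReal hb, ← mul_assoc,
    ← ENNReal.ofReal_inv_of_pos hp0, ← ENNReal.ofReal_mul (by positivity), one_div]

lemma measurableSet_lt_localDelay (hnet : IsAlohaNetwork lam p X h t P) (hθ : 0 < θ)
    (hx₀ : 0 < ‖x₀‖) (n : ℕ) :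
    MeasurableSet {ω | (n : ℕ∞) < localDelay α W N₀ θ x₀ X h t ω} := by
  have hY : ∀ k, Measurable fun ω => ((fun i => X i ω, fun j => (h k j ω, t k j ω)) :
      (ℕ → EuclideanSpace ℝ (Fin d)) × (Option ℕ → ℝ × Bool)) := fun k =>
    (measurable_pi_lambda _ hnet.poisson.measurable_point).prodMk (measurable_pi_lambda _ fun j =>
      (hnet.measurable_fading k j).prodMk (hnet.measurable_transmit k j))
  simp_rw [localDelay, lt_iInf_succ_iff, success_iff_mem_successSet hθ hx₀]
  have : {ω | ∀ k < n, ((fun i => X i ω, fun j => (h k j ω, t k j ω)) :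
      (ℕ → EuclideanSpace ℝ (Fin d)) × (Option ℕ → ℝ × Bool)) ∉
        successSet α (θ * ‖x₀‖ ^ α * W * N₀) (θ * ‖x₀‖ ^ α)} =
      ⋂ k ∈ Finset.range n, (fun ω => ((fun i => X i ω, fun j => (h k j ω, t k j ω)) :
        (ℕ → EuclideanSpace ℝ (Fin d)) × (Option ℕ → ℝ × Bool))) ⁻¹'
        (successSet α (θ * ‖x₀‖ ^ α * W * N₀) (θ * ‖x₀‖ ^ α))ᶜ := by
    ext; simp
  rw [this]
  exact Finset.measurableSet_biInter _ fun k _ => hY k (measurableSet_successSet _ _ _).compl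

/-- The tail of the local delay: given the interferers, it is geometric. -/
lemma measure_lt_localDelay [IsProbabilityMeasure P] (hnet : IsAlohaNetwork lam p X h t P)
    (hp0 : 0 ≤ p) (hp1 : p < 1) (hθ : 0 < θ) (hx₀ : 0 < ‖x₀‖) (n : ℕ) :
    P {ω | (n : ℕ∞) < localDelay α W N₀ θ x₀ X h t ω} =
      ∫⁻ ω, (1 - slotSuccessProb α (θ * ‖x₀‖ ^ α * W * N₀) (θ * ‖x₀‖ ^ α) p
        (fun i => X i ω)) ^ n ∂P := by
  simp_rw [localDelay, lt_iInf_succ_iff, success_iff_mem_successSet hθ hx₀]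
  have hM : ∀ kj : ℕ × Option ℕ, Measurable fun ω => (h kj.1 kj.2 ω, t kj.1 kj.2 ω) := fun kj =>
    (hnet.measurable_fading _ _).prodMk (hnet.measurable_transmit _ _)
  refine measure_forall_notMem (ξ := fun ω i => X i ω) (Y := fun k ω j => (h k j ω, t k j ω))
    (measurable_pi_lambda _ hnet.poisson.measurable_point)
    (fun k => measurable_pi_lambda _ fun j => hM (k, j)) ?_
    (iIndepFun_curry hM hnet.indep_marks) (measurableSet_successSet _ _ _) (fun k x => ?_) n
  · exact hnet.indep_points_marks.comp measurable_id
      (MeasurableEquiv.curry ℕ (Option ℕ) (ℝ × Bool)).measurable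
  · exact measure_slot_success hp0 hp1 (hnet.measurable_fading k) (hnet.measurable_transmit k)
      (hnet.fading_law k) (hnet.transmit_prob k) (hnet.indep_fading_transmit k)
      (hnet.indep_marks.precomp (Prod.mk_right_injective k))
      (ENNReal.ofReal (θ * ‖x₀‖ ^ α * W * N₀)) (fun i => scaledGain α (θ * ‖x₀‖ ^ α) (x i))

end Network

theorem theorem4 {Ω : Type*} [MeasurableSpace Ω] (P : Measure Ω) [IsProbabilityMeasure P]
    (d : ℕ) (hd : 1 ≤ d)
    (lam α θ W N₀ r₀ p : ℝ) (hlam : 0 < lam) (hα : (d : ℝ) < α) (hθ : 0 < θ) (hW : 0 < W)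
    (hN₀ : 0 ≤ N₀) (hr₀ : 0 < r₀) (hp0 : 0 < p) (hp1 : p < 1)
    (x₀ : EuclideanSpace ℝ (Fin d)) (hx₀ : ‖x₀‖ = r₀)
    (X : ℕ → Ω → EuclideanSpace ℝ (Fin d)) (h : ℕ → Option ℕ → Ω → ℝ)
    (t : ℕ → Option ℕ → Ω → Bool) (hnet : IsAlohaNetwork lam p X h t P)
    (δ A B D : ℝ) (hδ : δ = d / α)
    (hA : A = lam * volume.real (Metric.ball (0 : EuclideanSpace ℝ (Fin d)) 1) * r₀ ^ d * θ ^ δ *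
      (1 / Real.sinc (Real.pi * δ)))
    (hB : B = θ * r₀ ^ α * W * N₀)
    (hD : D = 1 / p * Real.exp (p * A / (1 - p) ^ (1 - δ) + B)) :
    (∀ᵐ ω ∂P, localDelay α W N₀ θ x₀ X h t ω ≠ ⊤) ∧
    MemLp (fun ω => ((localDelay α W N₀ θ x₀ X h t ω).toNat : ℝ)) 2 P ∧
    ∫ ω, ((localDelay α W N₀ θ x₀ X h t ω).toNat : ℝ) ∂P = D ∧
    variance (fun ω => ((localDelay α W N₀ θ x₀ X h t ω).toNat : ℝ)) P =
      2 / p ^ 2 * Real.exp ((2 - p - δ * p) * p * A / (1 - p) ^ (2 - δ) + 2 * B) - D - D ^ 2 := by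
  subst hx₀
  have hd' : (0 : ℝ) < d := by exact_mod_cast hd
  have hα0 : 0 < α := hd'.trans hα
  have hq : 0 < 1 - p := by linarith
  have hb : 0 ≤ B := by rw [hB]; positivity
  have hc : 0 < θ * ‖x₀‖ ^ α := by positivity
  have hν : SigmaFinite (ENNReal.ofReal lam • (volume : Measure (EuclideanSpace ℝ (Fin d)))) :=
    inferInstanceAs (SigmaFinite (Real.toNNReal lam • volume))
  have hF : Measurable fun x : EuclideanSpace ℝ (Fin d) =>
      elog (thinnedLaplace p (scaledGain α (θ * ‖x₀‖ ^ α) x))⁻¹ :=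
    measurable_elog.comp ((measurable_thinnedLaplace p).comp (measurable_scaledGain _ _)).inv
  have hE₁ := lintegral_eexp_tsum hnet.poisson hF
  -- Doubling the exponent squares every factor, giving the second inverse moment of Q.
  have hE₂ := lintegral_eexp_tsum hnet.poisson (hF.const_mul 2)
  rw [lintegral_smul_measure, smul_eq_mul,
    lintegral_inv_thinnedLaplace_sub_one hd hα hp0 hp1 hc, ← ENNReal.ofReal_mul hlam.le] at hE₁
  rw [lintegral_smul_measure, smul_eq_mul,
    lintegral_inv_thinnedLaplace_sq_sub_one hd hα hp0 hp1 hc, ← ENNReal.ofReal_mul hlam.le] at hE₂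
  have hpow₁ := pow_mul_inv_rpow_sub (d := d) hθ hr₀ hq hα0 1
  have hpow₂ := pow_mul_inv_rpow_sub (d := d) hθ hr₀ hq hα0 2
  rw [pow_one, Nat.cast_one, ← hδ] at hpow₁
  rw [Nat.cast_ofNat, ← hδ] at hpow₂
  rw [← hδ] at hE₁ hE₂
  have hδ1 : δ < 1 := by rw [hδ]; exact (div_lt_one hα0).2 hα
  have hκ : 0 < 1 / Real.sinc (Real.pi * δ) := by
    have hδ0 : 0 < δ := by rw [hδ]; positivity
    rw [← mul_Gamma_mul_Gamma_one_sub hδ0]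
    have := Real.Gamma_pos_of_pos hδ0
    have := Real.Gamma_pos_of_pos (sub_pos.2 hδ1)
    positivity
  have hA0 : 0 ≤ A := by rw [hA]; positivity
  have hexp₁ : lam * (p * (θ * ‖x₀‖ ^ α) *
      (volume.real (Metric.ball (0 : EuclideanSpace ℝ (Fin d)) 1) *
        (1 / Real.sinc (Real.pi * δ)) * (1 / ((1 - p) * (θ * ‖x₀‖ ^ α))) ^ (1 - δ))) =
      p * A / (1 - p) ^ (1 - δ) := by
    linear_combination (lam * p * volume.real (Metric.ball (0 : EuclideanSpace ℝ (Fin d)) 1) *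
      (1 / Real.sinc (Real.pi * δ))) * hpow₁ - p / (1 - p) ^ (1 - δ) * hA
  have hpow : (1 - p) ^ (2 - δ) = (1 - p) * (1 - p) ^ (1 - δ) := by
    rw [show 2 - δ = 1 + (1 - δ) by ring, Real.rpow_add hq, Real.rpow_one]
  have hexp₂ : lam * (2 * (p * (θ * ‖x₀‖ ^ α)) *
      (volume.real (Metric.ball (0 : EuclideanSpace ℝ (Fin d)) 1) *
        (1 / Real.sinc (Real.pi * δ)) * (1 / ((1 - p) * (θ * ‖x₀‖ ^ α))) ^ (1 - δ)) +
      (p * (θ * ‖x₀‖ ^ α)) ^ 2 *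
      (volume.real (Metric.ball (0 : EuclideanSpace ℝ (Fin d)) 1) *
        (1 / Real.sinc (Real.pi * δ)) *
        ((1 - δ) * (1 / ((1 - p) * (θ * ‖x₀‖ ^ α))) ^ (2 - δ)))) =
      (2 - p - δ * p) * p * A / (1 - p) ^ (2 - δ) := by
    have h3 : lam * ((p * (θ * ‖x₀‖ ^ α)) ^ 2 *
      (volume.real (Metric.ball (0 : EuclideanSpace ℝ (Fin d)) 1) *
        (1 / Real.sinc (Real.pi * δ)) *
        ((1 - δ) * (1 / ((1 - p) * (θ * ‖x₀‖ ^ α))) ^ (2 - δ)))) =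
        p ^ 2 * (1 - δ) * A / (1 - p) ^ (2 - δ) := by
      linear_combination (lam * p ^ 2 * (1 - δ) *
        volume.real (Metric.ball (0 : EuclideanSpace ℝ (Fin d)) 1) *
        (1 / Real.sinc (Real.pi * δ))) * hpow₂ - p ^ 2 * (1 - δ) / (1 - p) ^ (2 - δ) * hA
    -- The two contributions combine through 2 - p - δp = 2(1 - p) + p(1 - δ).
    have h4 : (2 - p - δ * p) * p * A / (1 - p) ^ (2 - δ) =
        2 * (p * A / (1 - p) ^ (1 - δ)) + p ^ 2 * (1 - δ) * A / (1 - p) ^ (2 - δ) := by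
      have : (1 - p) ^ (1 - δ) ≠ 0 := (Real.rpow_pos_of_pos hq _).ne'
      rw [hpow]
      field_simp
      ring
    rw [h4]
    linear_combination 2 * hexp₁ + h3
  have hJ₁ : 0 ≤ p * A / (1 - p) ^ (1 - δ) := by positivity
  have hJ₂ : 0 ≤ (2 - p - δ * p) * p * A / (1 - p) ^ (2 - δ) := by
    have : 0 ≤ 2 - p - δ * p := by nlinarith
    positivity
  rw [hexp₁, eexp_ofReal hJ₁] at hE₁
  rw [hexp₂, eexp_ofReal hJ₂] at hE₂
  have hm : ∀ n : ℕ, MeasurableSet {ω | (n : ℕ∞) < localDelay α W N₀ θ x₀ X h t ω} :=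
    measurableSet_lt_localDelay hnet hθ hr₀
  have htail := measure_lt_localDelay (α := α) (W := W) (N₀ := N₀) hnet hp0.le hp1 hθ hr₀
  rw [← hB] at htail
  have hQm : Measurable fun ω => slotSuccessProb α B (θ * ‖x₀‖ ^ α) p (fun i => X i ω) :=
    (measurable_slotSuccessProb _ _ _ _).comp
      (measurable_pi_lambda _ hnet.poisson.measurable_point)
  have hQ1 : ∀ ω, slotSuccessProb α B (θ * ‖x₀‖ ^ α) p (fun i => X i ω) ≤ 1 := fun ω =>
    slotSuccessProb_le_one hp1.le _ _ _
  have hEm : ∀ r : ℝ≥0∞, Measurable fun ω =>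
      eexp (∑' i, r * elog (thinnedLaplace p (scaledGain α (θ * ‖x₀‖ ^ α) (X i ω)))⁻¹) := fun r =>
    measurable_eexp.comp (Measurable.tsum fun i =>
      (hF.comp (hnet.poisson.measurable_point i)).const_mul r)
  -- Here `m₁` is `D` and `m₂` is the first term of the variance, equal to 2 E[1/Q²].
  refine moments_of_lintegral (measurable_toENNReal_of_measurableSet_lt hm)
    (by rw [hD]; positivity) (by positivity) ?_ ?_
  · rw [lintegral_toENNReal_of_tail hm hQm hQ1 htail]
    simp_rw [inv_slotSuccessProb hp0 hb]
    rw [lintegral_const_mul _ (by simpa using hEm 1), hE₁, ← ENNReal.ofReal_mul (by positivity), hD,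
      Real.exp_add]
    congr 1
    ring
  · rw [lintegral_sq_add_toENNReal_of_tail hm hQm hQ1 htail]
    have hsq : ∀ ω, ((slotSuccessProb α B (θ * ‖x₀‖ ^ α) p (fun i => X i ω))⁻¹) ^ 2 =
        ENNReal.ofReal ((1 / p * Real.exp B) ^ 2) * eexp (∑' i,
          2 * elog (thinnedLaplace p (scaledGain α (θ * ‖x₀‖ ^ α) (X i ω)))⁻¹) := fun ω => by
      rw [inv_slotSuccessProb hp0 hb, mul_pow, ENNReal.ofReal_pow (by positivity),
        ENNReal.tsum_mul_left, two_mul, eexp_add, sq (eexp _)]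
    simp_rw [hsq]
    rw [lintegral_const_mul _ (hEm 2), hE₂, ← ENNReal.ofReal_mul (by positivity),
      ← ENNReal.ofReal_ofNat, ← ENNReal.ofReal_mul (by positivity), Real.exp_add, two_mul B,
      Real.exp_add]
    congr 1
    ring
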